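/- Let $k$ be a separably closed field and let $\mathfrak{T}$ be a pre-Tannakian category over $k$: a $k$-linear abelian category with a symmetric monoidal structure whose tensor product is $k$-bilinear, in which every object has a dual, every object has finite length, all $\operatorname{Hom}$ spaces are finite dimensional over $k$, and $\operatorname{End}(\mathbb{1})=k$. An étale algebra in $\mathfrak{T}$ is a commutative, associative, unital algebra $A$ in $\mathfrak{T}$ whose trace pairing $A\otimes A\to\mathbb{1}$, $(x,y)\mapsto \operatorname{tr}(xy)$, is perfect; étale algebras with algebra homomorphisms form a category $\mathrm{Et}(\mathfrak{T})$. It is simple if it is non-zero and has no ideals other than $0$ and itself. An ordered étale algebra is a totally ordered object of $\mathrm{Et}(\mathfrak{T})^{\mathrm{op}}$, that is, an object $A$ together with a subobject $R\subset A\times A$ (in $\mathrm{Et}(\mathfrak{T})^{\mathrm{op}}$) such that the natural map $R\amalg\Delta_A\amalg R^{\mathrm{op}}\to A\times A$ is an isomorphism and $R_{12}\cap R_{23}\subset R_{13}$ in $A\times A\times A$, where $R_{ij}$ is the inverse image of $R$ under the projection to the $i$th and $j$th factors. Let $A$ be an ordered étale algebra in $\mathfrak{T}$, with categorical dimension $\dim(A)\in\operatorname{End}(\mathbb{1})=k$.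 (a) If $A$ is simple, then $\dim(A)\in\{1,-1,0\}$ (as elements of $k$). (b) In general, $\dim(A)$ is an integer, i.e. it lies in the image of $\mathbb{Z}\to k$. -/

import Mathlib

open CategoryTheory CategoryTheory.Limits MonoidalCategory MonObj

universe w v u

namespace OrderedEtale

section Orders

/-- A binary relation on an object `X` of a category: an object `R` with a jointly monic pair of
morphisms to `X`, i.e. (when `X × X` exists) a subobject of `X × X`. -/
structure BinaryRelation {S : Type u} [Category.{v} S] (X : S) where
  /-- the underlying object of the relation -/
  R : S
  /-- the first projection -/
  p : R ⟶ X
  /-- the second projection -/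
  q : R ⟶ X
  jointly_mono : ∀ {T : S} (a b : T ⟶ R), a ≫ p = b ≫ p → a ≫ q = b ≫ q → a = b

/-- The relation induced on `T`-points: `(a, b) : T ⟶ X × X` factors through `R`. -/
def BinaryRelation.Rel {S : Type u} [Category.{v} S] {X : S} (r : BinaryRelation X)
    {T : S} (a b : T ⟶ X) : Prop :=
  ∃ t : T ⟶ r.R, t ≫ r.p = a ∧ t ≫ r.q = b

/-- `R` is total: the product `X × X` exists, and the natural morphisms
`R ⟶ X × X`, `Δ : X ⟶ X × X` and `Rᵒᵖ ⟶ X × X` exhibit it as the coproduct `R ⨿ Δ_X ⨿ Rᵒᵖ`. -/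
def BinaryRelation.IsTotal {S : Type u} [Category.{v} S] {X : S} (r : BinaryRelation X) : Prop :=
  ∃ (P : BinaryFan X X) (hP : IsLimit P),
    ∀ (Z : S) (f : r.R ⟶ Z) (g : X ⟶ Z) (h : r.R ⟶ Z), ∃! l : P.pt ⟶ Z,
      hP.lift (BinaryFan.mk r.p r.q) ≫ l = f ∧
      hP.lift (BinaryFan.mk (𝟙 X) (𝟙 X)) ≫ l = g ∧
      hP.lift (BinaryFan.mk r.q r.p) ≫ l = h

/-- `R` is transitive: `R₁₂ ∩ R₂₃ ⊆ R₁₃` as subobjects of `X × X × X`, expressed on `T`-points. -/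
def BinaryRelation.IsTransitive {S : Type u} [Category.{v} S] {X : S}
    (r : BinaryRelation X) : Prop :=
  ∀ (T : S) (a b c : T ⟶ X), r.Rel a b → r.Rel b c → r.Rel a c

/-- A (strictly) totally ordered object of a category. -/
structure OrderedObject (S : Type u) [Category.{v} S] where
  /-- the underlying object -/
  obj : S
  /-- the strict order relation `<` -/
  lt : BinaryRelation obj
  total : lt.IsTotal
  transitive : lt.IsTransitive

end Orders

section Algebras

variable {T : Type u} [Category.{v} T] [MonoidalCategory T] [SymmetricCategory T]

/-- The categorical dimension `𝟙 ⟶ X ⊗ Xᘁ ≅ Xᘁ ⊗ X ⟶ 𝟙` of a rigid object. -/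
def dim (X : T) [HasRightDual X] : End (𝟙_ T) :=
  η_ X Xᘁ ≫ (β_ X Xᘁ).hom ≫ ε_ X Xᘁ

/-- The trace map `A ⟶ 𝟙` of a rigid algebra: an element is sent to the trace of
multiplication by it, i.e. `A ⟶ A ⊗ A ⊗ Aᘁ ⟶ A ⊗ Aᘁ ≅ Aᘁ ⊗ A ⟶ 𝟙`. -/
def algTrace (A : T) [MonObj A] [HasRightDual A] : A ⟶ 𝟙_ T :=
  (ρ_ A).inv ≫ A ◁ η_ A Aᘁ ≫ (α_ A A Aᘁ).inv ≫ μ[A] ▷ Aᘁ ≫ (β_ A Aᘁ).hom ≫ ε_ A Aᘁ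

/-- The trace pairing `A ⊗ A ⟶ 𝟙`, `(x, y) ↦ tr (x y)`. -/
def tracePairing (A : T) [MonObj A] [HasRightDual A] : A ⊗ A ⟶ 𝟙_ T :=
  μ[A] ≫ algTrace A

/-- An algebra is étale if its trace pairing is perfect, i.e. is the evaluation of a duality
between `A` and itself. -/
def IsEtale (A : T) [MonObj A] [HasRightDual A] : Prop :=
  ∃ e : ExactPairing A A, e.evaluation' = tracePairing A

/-- An algebra is simple if it is nonzero and every ideal (subobject stable under multiplication
by `A`) is zero or everything. -/
def IsSimpleAlgebra (A : T) [MonObj A] : Prop :=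
  ¬ IsZero A ∧ ∀ (I : T) (i : I ⟶ A) [Mono i],
    (∃ a : A ⊗ I ⟶ I, a ≫ i = A ◁ i ≫ μ[A]) → IsZero I ∨ IsIso i

variable (T) in
/-- The category `Et(T)` of (commutative) étale algebras and algebra homomorphisms. -/
abbrev EtaleAlg [RigidCategory T] :=
  ObjectProperty.FullSubcategory (fun A : CommMon T => IsEtale A.X)

variable (T) in
/-- An ordered étale algebra is a totally ordered object of `Et(T)ᵒᵖ`. -/
abbrev OrderedEtaleAlg [RigidCategory T] := OrderedObject (EtaleAlg T)ᵒᵖ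

/-- The commutative algebra underlying an ordered étale algebra. -/
abbrev OrderedEtaleAlg.alg [RigidCategory T] (A : OrderedEtaleAlg T) : CommMon T :=
  A.obj.unop.obj

end Algebras

/-- The finiteness conditions making a rigid abelian `k`-linear symmetric monoidal category (with
`k`-bilinear tensor product) pre-Tannakian: all objects have finite length, all `Hom` spaces are
finite dimensional and `End(𝟙) = k`. -/
class IsPreTannakian (k : Type w) [Field k] (T : Type u) [Category.{v} T] [Abelian T] [Linear k T]
    [MonoidalCategory T] [SymmetricCategory T] [MonoidalPreadditive T] [MonoidalLinear k T]
    [RigidCategory T] : Prop where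
  noetherian : ∀ X : T, IsNoetherianObject X
  artinian : ∀ X : T, IsArtinianObject X
  finite_hom : ∀ X Y : T, Module.Finite k (X ⟶ Y)
  end_unit : Function.Bijective (algebraMap k (End (𝟙_ T)))

end OrderedEtale

/-!
# The dimension of an ordered étale algebra

Commutative algebras in `T` are viewed as the algebras of functions on spaces, so that `X ⊗ X` is
the algebra of functions on the square of the space of `X`, the elements `𝟙 ⟶ X` are global
functions (`Points X`, a commutative ring), and contraction of the second factor of `D ⊗ X` with the
trace is integration along the fibres of the first projection (`Points.integral`). It satisfies the
projection formula, base change and Fubini's theorem, and integrating the constant function `1`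
gives the dimension of `X` (`one_comp_algTrace`).

*Translating the order.* Étale algebras are closed under tensor products, products and direct
factors (`IsEtale.tensor`, `IsEtale.prod`, `IsEtale.factor`); this is proved without computing
traces, by describing étale algebras through a copairing `c` with `c ≫ μ = η` (`EtalePairing`).
Hence `X ⊗ X` is the categorical square of `X` in the opposite of the category of étale algebras,
and totality of the order turns it into a product of three algebras. So the order is given by an
idempotent `r` of `Points (X ⊗ X)`, the indicator function of `{x < y}`, such that
`r (x, y) + c (x, y) + r (y, x) = 1`, where `c` turns out to be the indicator function of the
diagonal. Transitivity, tested on the direct factor cut out by the idempotent `r (a, b) * r (b, c)`,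
says that this idempotent is annihilated by `1 - r (a, c)` (`OrderedEtaleAlg.exists_isStrictOrder`).

*Reduction to a connected component.* The ring `Points X` is finite dimensional over `k`, and it is
reduced, because a function of square zero is orthogonal to everything for the trace pairing
(`IsEtale.isReduced_points`). As `k` is separably closed, `1` is a sum of orthogonal idempotents `e`
each of which cuts out a purely inseparable extension of `k` (`exists_geometricPoints`). Since the
points of `X ⊗ X` form a reduced ring too, a function on the component of `e` takes the same value
at any two points of that component (`IsGeometricPoint.mul_sub_eq_zero`).

*The computation.* Let `f` be the function `x ↦ ∫ r (x, y) e (y) dy` on the component of `e`, the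
measure of the set of the `y > x` there. For `y, z > x` exactly one of `y < z`, `y = z`, `z < y`
holds. Integrating over `y` and `z`, transitivity and the fact that `f` takes equal values at `x`
and `y` give `f² = f² + f + f²` (`IsStrictOrder.integral_mul_integral`). Thus `-f` is idempotent, and
`f` is `0` or `-e` (`IsStrictOrder.mul_integral_eq`). The same holds for the measure `f'` of the set
of the `y < x`, so that the trace of `e`, which satisfies `tr e • e = f + e + f'`, is `1`, `0` or
`-1` (`IsStrictOrder.trace_eq`). Summing over `e` shows that the dimension is an integer; if `X` is
simple, then one of the idempotents `e` is `1`, whose trace is the dimension.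
-/

set_option linter.unusedSectionVars false

namespace OrderedEtale

/-! ### Tensor products of algebras as coproducts -/

section TensorAlgebra

variable {T : Type u} [Category.{v} T] [MonoidalCategory T] [SymmetricCategory T]

instance isMonHom_one (M : T) [MonObj M] : IsMonHom η[M] where
  one_hom := by simp
  mul_hom := by simp [unitors_equal]

/-- The first coprojection `D ⟶ D ⊗ A` of a tensor product of algebras. -/
def inl (D A : T) [MonObj A] : D ⟶ D ⊗ A := (ρ_ D).inv ≫ D ◁ η[A]

/-- The second coprojection `A ⟶ D ⊗ A` of a tensor product of algebras. -/
def inr (D A : T) [MonObj D] : A ⟶ D ⊗ A := (λ_ A).inv ≫ η[D] ▷ A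

/-- The morphism `a · b : X ⊗ Y ⟶ D`, `(x, y) ↦ a x * b y`, for morphisms `a : X ⟶ D` and
`b : Y ⟶ D` to an algebra. For algebra morphisms into a commutative algebra, it is the induced
morphism out of the coproduct `X ⊗ Y`. -/
def desc {X Y D : T} [MonObj D] (a : X ⟶ D) (b : Y ⟶ D) : X ⊗ Y ⟶ D := (a ⊗ₘ b) ≫ μ[D]

variable {X Y Z W D D' A : T} [MonObj D] [MonObj D'] [MonObj A]

instance : IsMonHom (inl D A) := by unfold inl; infer_instance
instance : IsMonHom (inr D A) := by unfold inr; infer_instance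

lemma desc_comp (a : X ⟶ D) (b : Y ⟶ D) (f : D ⟶ D') [IsMonHom f] :
    desc a b ≫ f = desc (a ≫ f) (b ≫ f) := by
  simp [desc]

lemma tensorHom_desc (f : Z ⟶ X) (g : W ⟶ Y) (a : X ⟶ D) (b : Y ⟶ D) :
    (f ⊗ₘ g) ≫ desc a b = desc (f ≫ a) (g ≫ b) := by
  simp [desc]

lemma desc_assoc (a : X ⟶ D) (b : Y ⟶ D) (c : Z ⟶ D) :
    desc (desc a b) c = (α_ X Y Z).hom ≫ desc a (desc b c) := by
  simp only [desc, mon_tauto]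

lemma braiding_desc [IsCommMonObj D] (a : X ⟶ D) (b : Y ⟶ D) :
    (β_ Y X).hom ≫ desc a b = desc b a := by
  rw [desc, ← BraidedCategory.braiding_naturality_assoc, IsCommMonObj.mul_comm, desc]

/-- Multiplication by the first factor on a tensor product of algebras. -/
lemma desc_inl_id : desc (inl D A) (𝟙 (D ⊗ A)) = (α_ D D A).inv ≫ μ[D] ▷ A := by
  simp only [desc, inl, tensorObj.mul_def]
  have := tensorμ_natural_left (𝟙 D) η[A] D A
  simp only [id_tensorHom, tensorHom_id] at this ⊢
  rw [comp_whiskerRight_assoc, reassoc_of% this, tensorHom_comp_tensorHom, MonObj.one_mul,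
    MonoidalCategory.tensorHom_def]
  simp [tensorμ, -IsMonHom.mul_hom, -IsMonHom.mul_hom_assoc]
  monoidal

/-- Multiplication by the second factor on a tensor product of algebras. -/
lemma desc_id_inr : desc (𝟙 (D ⊗ A)) (inr D A) = (α_ D A A).hom ≫ D ◁ μ[A] := by
  simp only [desc, inr, tensorObj.mul_def]
  have := tensorμ_natural_right D A η[D] (𝟙 A)
  simp only [id_tensorHom, tensorHom_id] at this ⊢
  rw [whiskerLeft_comp_assoc, reassoc_of% this, tensorHom_comp_tensorHom, MonObj.mul_one,
    MonoidalCategory.tensorHom_def]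
  simp [tensorμ, -IsMonHom.mul_hom, -IsMonHom.mul_hom_assoc]
  monoidal

lemma desc_inl_inr : desc (inl D A) (inr D A) = 𝟙 (D ⊗ A) := by
  have := tensorHom_desc (𝟙 D) (inr D A) (inl D A) (𝟙 _)
  rw [Category.id_comp, Category.comp_id] at this
  rw [← this, desc_inl_id]
  simp only [inr, MonoidalCategory.whiskerLeft_comp, id_tensorHom, Category.assoc]
  rw [associator_inv_naturality_middle_assoc, ← comp_whiskerRight, MonObj.mul_one]
  monoidal

@[simp] lemma inl_desc (a : D ⟶ D') (b : A ⟶ D') [IsMonHom b] :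
    inl D A ≫ desc a b = a := by
  simp [inl, desc, ← id_tensorHom]

@[simp] lemma inr_desc (a : D ⟶ D') (b : A ⟶ D') [IsMonHom a] :
    inr D A ≫ desc a b = b := by
  simp [inr, desc, ← tensorHom_id]

lemma eq_desc (f : D ⊗ A ⟶ D') [IsMonHom f] : f = desc (inl D A ≫ f) (inr D A ≫ f) := by
  rw [← desc_comp, desc_inl_inr, Category.id_comp]

lemma hom_ext_tensor {f g : D ⊗ A ⟶ D'} [IsMonHom f] [IsMonHom g]
    (h₁ : inl D A ≫ f = inl D A ≫ g) (h₂ : inr D A ≫ f = inr D A ≫ g) : f = g := by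
  rw [eq_desc f, eq_desc g, h₁, h₂]

instance isMonHom_mul [IsCommMonObj D] : IsMonHom μ[D] where
  one_hom := by simp [tensorObj.one_def, ← unitors_equal]
  mul_hom := by
    rw [tensorObj.mul_def]
    simp only [mon_tauto]

instance isMonHom_desc [IsCommMonObj D'] (a : D ⟶ D') (b : A ⟶ D') [IsMonHom a] [IsMonHom b] :
    IsMonHom (desc a b) := by unfold desc; infer_instance

end TensorAlgebra

/-! ### Traces and étale pairings -/

section Trace

variable {T : Type u} [Category.{v} T] [MonoidalCategory T] [SymmetricCategory T]

/-- The partial trace `W ⟶ 𝟙` of a morphism `W ⊗ X ⟶ X`, a family of endomorphisms of `X`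
parametrised by `W`. The trace of an algebra is the partial trace of its multiplication. -/
def partialTrace {W : T} (X : T) [HasRightDual X] (f : W ⊗ X ⟶ X) : W ⟶ 𝟙_ T :=
  (ρ_ W).inv ≫ W ◁ η_ X Xᘁ ≫ (α_ W X Xᘁ).inv ≫ f ▷ Xᘁ ≫ (β_ X Xᘁ).hom ≫ ε_ X Xᘁ

/-- Cyclicity of the partial trace. For `g` the identity, with two different duals of the same
object, it says that the partial trace does not depend on the choice of the dual. -/
lemma partialTrace_comp {W X X' : T} [HasRightDual X] [HasRightDual X'] (f : W ⊗ X ⟶ X')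
    (g : X' ⟶ X) : partialTrace X (f ≫ g) = partialTrace X' (W ◁ g ≫ f) := by
  have h1 : g ▷ Xᘁ ≫ (β_ X Xᘁ).hom ≫ ε_ X Xᘁ =
      X' ◁ gᘁ ≫ (β_ X' X'ᘁ).hom ≫ ε_ X' X'ᘁ := by
    rw [BraidedCategory.braiding_naturality_left_assoc, ← rightAdjointMate_comp_evaluation,
      BraidedCategory.braiding_naturality_right_assoc]
  unfold partialTrace
  rw [comp_whiskerRight, Category.assoc, h1, ← whisker_exchange_assoc, comp_whiskerRight,
    Category.assoc, ← associator_inv_naturality_middle_assoc,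
    ← MonoidalCategory.whiskerLeft_comp_assoc, ← coevaluation_comp_rightAdjointMate]
  simp

variable {A : T} [MonObj A]

/-- A perfect pairing `(x, y) ↦ tr (x * y)` on an algebra, with copairing `c`, such that the
product of the two components of `c` is `1`. The last condition is equivalent to `tr` being the
trace of the algebra (`EtalePairing.algTrace_eq`), so that this is a description of étale algebras
that does not refer to traces. -/
structure EtalePairing (tr : A ⟶ 𝟙_ T) (c : 𝟙_ T ⟶ A ⊗ A) : Prop where
  zigzag_left : A ◁ c ≫ (α_ A A A).inv ≫ (μ ≫ tr) ▷ A = (ρ_ A).hom ≫ (λ_ A).inv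
  zigzag_right : c ▷ A ≫ (α_ A A A).hom ≫ A ◁ (μ ≫ tr) = (λ_ A).hom ≫ (ρ_ A).inv
  comp_mul : c ≫ μ = η

variable {tr : A ⟶ 𝟙_ T} {c : 𝟙_ T ⟶ A ⊗ A}

/-- The self-duality of an algebra defined by an étale pairing. -/
abbrev EtalePairing.exactPairing (h : EtalePairing tr c) : ExactPairing A A where
  coevaluation' := c
  evaluation' := μ ≫ tr
  coevaluation_evaluation' := h.zigzag_left
  evaluation_coevaluation' := h.zigzag_right

/-- The trace of a self-dual commutative algebra is `x ↦ tr (x * m)`, where `m` is the product of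
the two components of the copairing. -/
lemma algTrace_eq_of_exactPairing [IsCommMonObj A] [HasRightDual A] (e : ExactPairing A A)
    (he : e.evaluation' = μ ≫ tr) :
    algTrace A = (ρ_ A).inv ≫ A ◁ (e.coevaluation' ≫ μ) ≫ μ ≫ tr := by
  have h1 : algTrace A = @partialTrace _ _ _ _ A A ⟨A⟩ μ := by
    have := @partialTrace_comp _ _ _ _ A A A _ ⟨A⟩ μ (𝟙 A)
    rw [Category.comp_id, MonoidalCategory.whiskerLeft_id, Category.id_comp] at this
    exact this
  have h2 : @partialTrace _ _ _ _ A A ⟨A⟩ μ =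
    (ρ_ A).inv ≫ A ◁ e.coevaluation' ≫ (α_ A A A).inv ≫ μ ▷ A ≫ (β_ A A).hom ≫ e.evaluation' := rfl
  rw [h1, h2, he, IsCommMonObj.mul_comm_assoc, MonObj.mul_assoc_assoc]
  simp

lemma EtalePairing.algTrace_eq [IsCommMonObj A] [HasRightDual A] (h : EtalePairing tr c) :
    algTrace A = tr := by
  rw [algTrace_eq_of_exactPairing (tr := tr) h.exactPairing rfl]
  change (ρ_ A).inv ≫ A ◁ (c ≫ μ) ≫ μ ≫ tr = tr
  rw [h.comp_mul, MonObj.mul_one_assoc, Iso.inv_hom_id_assoc]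

lemma EtalePairing.isEtale [IsCommMonObj A] [HasRightDual A] (h : EtalePairing tr c) :
    IsEtale A :=
  ⟨h.exactPairing, by rw [tracePairing, h.algTrace_eq]; rfl⟩

/-- A point `x` of a self-dual algebra is recovered from the functional `y ↦ tr (y * x)`. -/
lemma eq_of_exactPairing (e : ExactPairing A A) (he : e.evaluation' = μ ≫ tr) (x : 𝟙_ T ⟶ A) :
    x = (ρ_ _).inv ≫ e.coevaluation' ▷ 𝟙_ T ≫
      (α_ A A _).hom ≫ A ◁ (A ◁ x ≫ μ ≫ tr) ≫ (ρ_ A).hom := by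
  have h : (λ_ _).inv ≫ 𝟙_ T ◁ x ≫ (e.coevaluation' ▷ A ≫ (α_ A A A).hom ≫
      A ◁ e.evaluation') ≫ (ρ_ A).hom = x := by
    rw [e.evaluation_coevaluation']
    simp
  rw [he] at h
  refine h.symm.trans ?_
  simp only [Category.assoc]
  rw [whisker_exchange_assoc]
  simp [unitors_inv_equal]

lemma IsEtale.exists_etalePairing [IsCommMonObj A] [HasRightDual A] (h : IsEtale A) :
    ∃ c : 𝟙_ T ⟶ A ⊗ A, EtalePairing (algTrace A) c := by
  obtain ⟨e, he⟩ := h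
  rw [tracePairing] at he
  refine ⟨e.coevaluation', ⟨by rw [← he]; exact e.coevaluation_evaluation',
    by rw [← he]; exact e.evaluation_coevaluation', ?_⟩⟩
  -- The elements `1` and `m := c ≫ μ` of `A` represent the same functional `y ↦ tr y`.
  have h1 := algTrace_eq_of_exactPairing e he
  set m := e.coevaluation' ≫ μ with hm
  have h4 : A ◁ m ≫ μ ≫ algTrace A = A ◁ η ≫ μ ≫ algTrace A := by
    rw [MonObj.mul_one_assoc, ← Iso.inv_comp_eq, ← h1]
  rw [eq_of_exactPairing e he m, h4, ← eq_of_exactPairing e he]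

/-- In an étale algebra, `x * c₁ ⊗ c₂ = c₁ ⊗ c₂ * x`. -/
lemma EtalePairing.bimodule (h : EtalePairing tr c) :
    (ρ_ A).inv ≫ A ◁ c ≫ (α_ A A A).inv ≫ μ ▷ A =
      (λ_ A).inv ≫ c ▷ A ≫ (α_ A A A).hom ≫ A ◁ μ := by
  let := h.exactPairing
  have h0 (f : A ⟶ A ⊗ A) : (tensorRightHomEquiv A A A A).symm f =
    f ▷ A ≫ (α_ A A A).hom ≫ A ◁ (μ ≫ tr) ≫ (ρ_ A).hom := rfl
  apply (tensorRightHomEquiv A A A A).symm.injective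
  rw [h0, h0]
  rw [← cancel_mono (ρ_ A).inv]
  simp only [Category.assoc, Iso.hom_inv_id, Category.comp_id]
  trans μ ≫ (ρ_ A).inv
  · calc
      _ = (A ◁ (λ_ A).inv ≫ A ◁ c ▷ A) ⊗≫ (μ ▷ (A ⊗ A) ≫ A ◁ (μ ≫ tr)) := by monoidal
      _ = A ◁ (λ_ A).inv ≫ A ◁ (c ▷ A ≫ (α_ A A A).hom ≫ A ◁ (μ ≫ tr)) ⊗≫ μ ▷ 𝟙_ T := by
        rw [← whisker_exchange]; monoidal
      _ = _ := by rw [h.zigzag_right]; monoidal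
  · symm
    calc
      _ = (λ_ _).inv ≫ c ▷ (A ⊗ A) ⊗≫ A ◁ ((α_ A A A).inv ≫ μ ▷ A ≫ μ ≫ tr) := by monoidal
      _ = (λ_ _).inv ≫ (c ▷ (A ⊗ A) ≫ (A ⊗ A) ◁ μ) ⊗≫ A ◁ (μ ≫ tr) := by
        rw [MonObj.mul_assoc_assoc]; monoidal
      _ = (λ_ _).inv ≫ 𝟙_ T ◁ μ ≫ (c ▷ A ≫ (α_ A A A).hom ≫ A ◁ (μ ≫ tr)) := by
        rw [← whisker_exchange]; monoidal
      _ = _ := by rw [h.zigzag_right]; simp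

/-- The copairing of a commutative étale algebra is supported on the diagonal:
`c * u = c * (1 ⊗ μ u)` for every (generalised) element `u` of `A ⊗ A`. -/
lemma EtalePairing.desc_id [IsCommMonObj A] (h : EtalePairing tr c) :
    desc c (𝟙 (A ⊗ A)) = desc c (μ ≫ inr A A) := by
  have h1 : desc c (inr A A) = c ▷ A ≫ (α_ A A A).hom ≫ A ◁ μ := by
    rw [← desc_id_inr, ← tensorHom_id, tensorHom_desc, Category.id_comp, Category.comp_id]
  have h2 : desc (inl A A) c = A ◁ c ≫ (α_ A A A).inv ≫ μ ▷ A := by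
    rw [← desc_inl_id, ← id_tensorHom, tensorHom_desc, Category.id_comp, Category.comp_id]
  have h3 : desc c (inl A A) = desc c (inr A A) := by
    rw [← braiding_desc, h1, h2, ← cancel_epi (λ_ A).inv, ← h.bimodule]
    simp
  have h4 : μ ≫ inr A A = desc (inr A A) (inr A A) := IsMonHom.mul_hom _
  rw [h4, ← desc_inl_inr, ← cancel_epi (α_ _ _ _).hom, ← desc_assoc, ← desc_assoc, h3]

end Trace

/-! ### Tensor products of étale pairings -/

section TensorPairing

variable {C D : Type*} [Category* C] [Category* D] [MonoidalCategory C] [MonoidalCategory D]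

open Functor.LaxMonoidal Functor.OplaxMonoidal in
/-- A monoidal functor preserves exact pairings. -/
abbrev exactPairingMap (F : C ⥤ D) [F.Monoidal] {X Y : C} (e : ExactPairing X Y) :
    ExactPairing (F.obj X) (F.obj Y) where
  coevaluation' := ε F ≫ F.map e.coevaluation' ≫ δ F X Y
  evaluation' := Functor.LaxMonoidal.μ F Y X ≫ F.map e.evaluation' ≫ Functor.OplaxMonoidal.η F
  coevaluation_evaluation' := by
    trans F.obj Y ◁ ε F ≫ Functor.LaxMonoidal.μ F Y (𝟙_ C) ≫
      F.map (Y ◁ e.coevaluation' ≫ (α_ Y X Y).inv ≫ e.evaluation' ▷ Y) ≫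
        δ F (𝟙_ C) Y ≫ Functor.OplaxMonoidal.η F ▷ F.obj Y
    · simp only [Functor.map_comp, Functor.Monoidal.map_whiskerLeft,
        Functor.Monoidal.map_whiskerRight, Functor.Monoidal.map_associator_inv, Category.assoc,
        Functor.Monoidal.μ_δ_assoc, MonoidalCategory.whiskerLeft_comp, comp_whiskerRight]
    · rw [e.coevaluation_evaluation']
      simp
  evaluation_coevaluation' := by
    trans ε F ▷ F.obj X ≫ Functor.LaxMonoidal.μ F (𝟙_ C) X ≫
      F.map (e.coevaluation' ▷ X ≫ (α_ X Y X).hom ≫ X ◁ e.evaluation') ≫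
        δ F X (𝟙_ C) ≫ F.obj X ◁ Functor.OplaxMonoidal.η F
    · simp only [Functor.map_comp, Functor.Monoidal.map_whiskerLeft,
        Functor.Monoidal.map_whiskerRight, Functor.Monoidal.map_associator, Category.assoc,
        Functor.Monoidal.μ_δ_assoc, MonoidalCategory.whiskerLeft_comp, comp_whiskerRight]
    · rw [e.evaluation_coevaluation']
      simp

/-- The exact pairing in a product category with given components. -/
abbrev exactPairingProd {X Y : C} {X' Y' : D} (e : ExactPairing X Y) (e' : ExactPairing X' Y') :
    ExactPairing (C := C × D) (X, X') (Y, Y') where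
  coevaluation' := (e.coevaluation', e'.coevaluation')
  evaluation' := (e.evaluation', e'.evaluation')
  coevaluation_evaluation' :=
    Prod.ext e.coevaluation_evaluation' e'.coevaluation_evaluation'
  evaluation_coevaluation' :=
    Prod.ext e.evaluation_coevaluation' e'.evaluation_coevaluation'

variable {T : Type u} [Category.{v} T] [MonoidalCategory T] [SymmetricCategory T]
  {A B : T} [MonObj A] [MonObj B]

/-- The étale pairing on a tensor product of algebras. -/
lemma EtalePairing.tensor {tr : A ⟶ 𝟙_ T} {c : 𝟙_ T ⟶ A ⊗ A} {tr' : B ⟶ 𝟙_ T}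
    {c' : 𝟙_ T ⟶ B ⊗ B} (h : EtalePairing tr c) (h' : EtalePairing tr' c') :
    EtalePairing (A := A ⊗ B) ((tr ⊗ₘ tr') ≫ (λ_ _).hom)
      ((λ_ _).inv ≫ (c ⊗ₘ c') ≫ tensorδ A B A B) := by
  let e : ExactPairing (A ⊗ B) (A ⊗ B) :=
    exactPairingMap (MonoidalCategory.tensor T) (exactPairingProd h.exactPairing h'.exactPairing)
  have hev : e.evaluation' = μ[A ⊗ B] ≫ (tr ⊗ₘ tr') ≫ (λ_ _).hom := by
    rw [tensorObj.mul_def]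
    simp only [Category.assoc, tensorHom_comp_tensorHom_assoc]
    rfl
  refine ⟨?_, ?_, ?_⟩
  · rw [← hev]; exact e.coevaluation_evaluation'
  · rw [← hev]; exact e.evaluation_coevaluation'
  · rw [tensorObj.mul_def, tensorObj.one_def]
    simp [h.comp_mul, h'.comp_mul]

end TensorPairing

/-! ### The ring of points of an algebra, and integration -/

section Points

variable {T : Type u} [Category.{v} T] [MonoidalCategory T] [SymmetricCategory T] [Preadditive T]
  [MonoidalPreadditive T]

/-- The points `𝟙 ⟶ D` of an object `D`. If `D` is a commutative algebra they form a commutative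
ring, the ring of global functions when `D` is thought of as the functions on a space. -/
@[ext]
structure Points (D : T) where
  /-- the underlying morphism -/
  hom : 𝟙_ T ⟶ D

namespace Points

variable {D D' A X : T} [MonObj D] [IsCommMonObj D] [MonObj D'] [IsCommMonObj D']
  [MonObj A] [IsCommMonObj A]

instance : Zero (Points X) := ⟨⟨0⟩⟩
instance : Add (Points X) := ⟨fun a b => ⟨a.hom + b.hom⟩⟩
instance : Neg (Points X) := ⟨fun a => ⟨-a.hom⟩⟩
instance : Sub (Points X) := ⟨fun a b => ⟨a.hom - b.hom⟩⟩
instance : SMul ℕ (Points X) := ⟨fun n a => ⟨n • a.hom⟩⟩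
instance : SMul ℤ (Points X) := ⟨fun n a => ⟨n • a.hom⟩⟩
instance : Mul (Points D) := ⟨fun a b => ⟨(λ_ (𝟙_ T)).inv ≫ desc a.hom b.hom⟩⟩
instance : One (Points D) := ⟨⟨η[D]⟩⟩

@[simp] lemma zero_hom : (0 : Points X).hom = 0 := rfl
@[simp] lemma add_hom (a b : Points X) : (a + b).hom = a.hom + b.hom := rfl
@[simp] lemma neg_hom (a : Points X) : (-a).hom = -a.hom := rfl
@[simp] lemma sub_hom (a b : Points X) : (a - b).hom = a.hom - b.hom := rfl
lemma mul_hom (a b : Points D) : (a * b).hom = (λ_ (𝟙_ T)).inv ≫ desc a.hom b.hom := rfl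
lemma one_hom : (1 : Points D).hom = η[D] := rfl

instance : AddCommGroup (Points X) :=
  Function.Injective.addCommGroup hom (fun _ _ => Points.ext) rfl (fun _ _ => rfl) (fun _ => rfl)
    (fun _ _ => rfl) (fun _ _ => rfl) (fun _ _ => rfl)

/-- Multiplication by a point of an algebra, as an endomorphism of the underlying object. -/
def mulHom (y : Points D) : D ⟶ D := (λ_ D).inv ≫ desc y.hom (𝟙 D)

@[simp] lemma comp_mulHom (x y : Points D) : x.hom ≫ mulHom y = (y * x).hom := by
  simp only [mulHom, mul_hom]
  rw [leftUnitor_inv_naturality_assoc, ← id_tensorHom, tensorHom_desc]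
  simp

lemma mulHom_mul (x y : Points D) : mulHom (x * y) = mulHom y ≫ mulHom x := by
  have h : mulHom (x * y) =
    ((λ_ D).inv ≫ (λ_ (𝟙_ T)).inv ▷ D) ≫ desc (desc x.hom y.hom) (𝟙 D) := by
    rw [mulHom, mul_hom, Category.assoc, ← tensorHom_id, tensorHom_desc, Category.comp_id]
  have h' : mulHom y ≫ mulHom x =
      ((λ_ D).inv ≫ 𝟙_ T ◁ (λ_ D).inv) ≫ desc x.hom (desc y.hom (𝟙 D)) := by
    rw [mulHom, mulHom, leftUnitor_inv_naturality_assoc, ← id_tensorHom, tensorHom_desc,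
      Category.assoc, Category.assoc, ← id_tensorHom, tensorHom_desc]
    simp
  rw [h, h', desc_assoc]
  simp

lemma mulHom_one : mulHom (1 : Points D) = 𝟙 D := by
  simp [mulHom, one_hom, desc]

@[simp] lemma one_comp_mulHom (x : Points D) : η[D] ≫ mulHom x = x.hom := by
  have : η[D] ≫ mulHom x = (λ_ (𝟙_ T)).inv ≫ desc x.hom η[D] := by
    rw [mulHom, leftUnitor_inv_naturality_assoc, ← id_tensorHom, tensorHom_desc]
    simp
  rw [this, desc, mul_one_hom, unitors_inv_equal, Iso.inv_hom_id_assoc]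

lemma mulHom_injective : Function.Injective (mulHom : Points D → (D ⟶ D)) := fun x y h => by
  ext
  rw [← one_comp_mulHom x, h, one_comp_mulHom]

lemma mulHom_add (x y : Points D) : mulHom (x + y) = mulHom x + mulHom y := by
  simp [mulHom, desc]

lemma mulHom_zero : mulHom (0 : Points D) = 0 := by
  simp [mulHom, desc]

protected lemma mul_comm (x y : Points D) : x * y = y * x := by
  ext
  rw [mul_hom, mul_hom, ← braiding_desc, ← cancel_epi (λ_ (𝟙_ T)).hom]
  simp [unitors_inv_equal]

instance : CommRing (Points D) :=
  { (inferInstance : AddCommGroup (Points D)) with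
    mul_assoc := fun x y z => mulHom_injective (by simp only [mulHom_mul, Category.assoc])
    one_mul := fun x => mulHom_injective (by simp [mulHom_mul, mulHom_one])
    mul_one := fun x => mulHom_injective (by simp [mulHom_mul, mulHom_one])
    zero_mul := fun x => mulHom_injective (by simp [mulHom_mul, mulHom_zero])
    mul_zero := fun x => mulHom_injective (by simp [mulHom_mul, mulHom_zero])
    left_distrib := fun x y z => mulHom_injective (by simp [mulHom_mul, mulHom_add])
    right_distrib := fun x y z => mulHom_injective (by simp [mulHom_mul, mulHom_add])
    mul_comm := Points.mul_comm }

section Linear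

variable {k : Type w} [Field k] [Linear k T] [MonoidalLinear k T]

instance : SMul k (Points X) := ⟨fun c a => ⟨c • a.hom⟩⟩

@[simp] lemma smul_hom (c : k) (a : Points X) : (c • a).hom = c • a.hom := rfl

/-- The underlying morphism, as an additive map. -/
def homAddHom : Points X →+ (𝟙_ T ⟶ X) where
  toFun := hom
  map_zero' := rfl
  map_add' _ _ := rfl

instance : Module k (Points X) :=
  Function.Injective.module k homAddHom (fun _ _ => Points.ext) (fun _ _ => rfl)

/-- The underlying morphism, as a linear isomorphism. -/
def homLinearEquiv : Points X ≃ₗ[k] (𝟙_ T ⟶ X) where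
  toFun := hom
  invFun := mk
  map_add' _ _ := rfl
  map_smul' _ _ := rfl

lemma mulHom_smul (c : k) (x : Points D) : mulHom (c • x) = c • mulHom x := by
  simp [mulHom, desc]

instance : Algebra k (Points D) :=
  Algebra.ofModule (fun c x y => mulHom_injective (by simp [mulHom_mul, mulHom_smul]))
    (fun c x y => mulHom_injective (by simp [mulHom_mul, mulHom_smul]))

end Linear

lemma desc_comp_mulHom_left (x : Points D) {Y Z : T} (a : Y ⟶ D) (b : Z ⟶ D) :
    desc a b ≫ mulHom x = desc (a ≫ mulHom x) b := by
  have h : desc a b ≫ mulHom x = (λ_ (Y ⊗ Z)).inv ≫ desc x.hom (desc a b) := by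
    rw [mulHom, leftUnitor_inv_naturality_assoc, ← id_tensorHom, tensorHom_desc]
    simp
  have h' : desc (a ≫ mulHom x) b = (λ_ Y).inv ▷ Z ≫ desc (desc x.hom a) b := by
    rw [mulHom, ← tensorHom_id, tensorHom_desc, leftUnitor_inv_naturality_assoc, ← id_tensorHom,
      tensorHom_desc]
    simp
  rw [h, h', desc_assoc]
  simp

lemma desc_comp_mulHom_right (x : Points D) {Y Z : T} (a : Y ⟶ D) (b : Z ⟶ D) :
    desc a b ≫ mulHom x = desc a (b ≫ mulHom x) := by
  rw [← braiding_desc, Category.assoc, desc_comp_mulHom_left, braiding_desc]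

lemma mul_comp_mulHom_left (x : Points D) : μ ≫ mulHom x = mulHom x ▷ D ≫ μ := by
  simpa [desc] using desc_comp_mulHom_left x (𝟙 D) (𝟙 D)

lemma mul_comp_mulHom_right (x : Points D) : μ ≫ mulHom x = D ◁ mulHom x ≫ μ := by
  simpa [desc] using desc_comp_mulHom_right x (𝟙 D) (𝟙 D)

lemma desc_hom_left (x : Points D) {Y : T} (a : Y ⟶ D) :
    desc x.hom a = (λ_ Y).hom ≫ a ≫ mulHom x := by
  rw [mulHom, leftUnitor_inv_naturality_assoc, Iso.hom_inv_id_assoc, ← id_tensorHom,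
    tensorHom_desc, Category.id_comp, Category.comp_id]

lemma desc_hom_right (x : Points D) {Y : T} (a : Y ⟶ D) :
    desc a x.hom = (ρ_ Y).hom ≫ a ≫ mulHom x := by
  rw [← braiding_desc, desc_hom_left]
  simp

/-- The ring homomorphism on points induced by an algebra homomorphism. -/
def map (f : D ⟶ D') [IsMonHom f] : Points D →+* Points D' where
  toFun x := ⟨x.hom ≫ f⟩
  map_one' := by ext; exact IsMonHom.one_hom f
  map_mul' x y := by ext; simp [mul_hom, desc_comp]
  map_zero' := by ext; simp
  map_add' x y := by ext; simp

@[simp] lemma map_hom (f : D ⟶ D') [IsMonHom f] (x : Points D) : (map f x).hom = x.hom ≫ f := rfl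

lemma mulHom_comp (f : D ⟶ D') [IsMonHom f] (x : Points D) :
    mulHom x ≫ f = f ≫ mulHom (map f x) := by
  rw [mulHom, mulHom, Category.assoc, desc_comp, leftUnitor_inv_naturality_assoc, ← id_tensorHom,
    tensorHom_desc]
  simp

lemma map_map {D'' : T} [MonObj D''] [IsCommMonObj D''] (f : D ⟶ D') [IsMonHom f]
    (g : D' ⟶ D'') [IsMonHom g] (x : Points D) : map g (map f x) = map (f ≫ g) x := by
  ext; simp

/-- Integration along the fibres of the first projection: contraction of the second factor of
`X ⊗ A` with a functional `tr` on `A`. -/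
def integral (tr : A ⟶ 𝟙_ T) : Points (X ⊗ A) →+ Points X where
  toFun g := ⟨g.hom ≫ X ◁ tr ≫ (ρ_ X).hom⟩
  map_zero' := by ext; simp
  map_add' x y := by ext; simp

variable (tr : A ⟶ 𝟙_ T)

lemma integral_hom (g : Points (X ⊗ A)) :
    (integral tr g).hom = g.hom ≫ X ◁ tr ≫ (ρ_ X).hom := rfl

/-- The projection formula. -/
lemma integral_inl_mul (d : Points D) (g : Points (D ⊗ A)) :
    integral tr (map (inl D A) d * g) = d * integral tr g := by
  ext
  have h1 : desc (d.hom ≫ inl D A) g.hom =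
      (d.hom ⊗ₘ g.hom) ≫ (α_ D D A).inv ≫ μ[D] ▷ A := by
    rw [← desc_inl_id, tensorHom_desc, Category.comp_id]
  have h2 : desc d.hom (g.hom ≫ D ◁ tr ≫ (ρ_ D).hom) =
      (d.hom ⊗ₘ g.hom) ≫ D ◁ (D ◁ tr ≫ (ρ_ D).hom) ≫ μ := by
    simp [desc, MonoidalCategory.tensorHom_def]
  rw [integral_hom, mul_hom, mul_hom, map_hom, integral_hom, h1, h2]
  simp only [Category.assoc]
  rw [← whisker_exchange_assoc]
  simp

/-- Base change: integration commutes with pullback. -/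
lemma integral_map (f : D ⟶ D') [IsMonHom f] (g : Points (D ⊗ A)) :
    integral tr (map (f ▷ A) g) = map f (integral tr g) := by
  ext
  simp only [integral_hom, map_hom, Category.assoc]
  rw [← whisker_exchange_assoc, rightUnitor_naturality]

/-- The integral of a function of the second variable only is a constant. -/
lemma integral_inr (x : Points A) :
    (integral tr (map (inr D A) x)).hom = (x.hom ≫ tr) ≫ η[D] := by
  simp only [integral_hom, map_hom, inr, Category.assoc]
  rw [← whisker_exchange_assoc, ← leftUnitor_inv_naturality_assoc, rightUnitor_naturality]
  simp [← unitors_equal]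

/-- The exchange of the last two factors of `(X ⊗ A) ⊗ A`. -/
def swapLast (X A : T) : (X ⊗ A) ⊗ A ⟶ (X ⊗ A) ⊗ A :=
  (α_ X A A).hom ≫ X ◁ (β_ A A).hom ≫ (α_ X A A).inv

instance : IsMonHom (swapLast D A) := by unfold swapLast; infer_instance

/-- Fubini's theorem: a double integral does not depend on the order of integration. -/
lemma integral_integral_swapLast (g : Points ((D ⊗ A) ⊗ A)) :
    integral tr (integral tr (map (swapLast D A) g)) = integral tr (integral tr g) := by
  have h : ((D ⊗ A) ◁ tr ≫ (ρ_ _).hom) ≫ D ◁ tr =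
      (α_ D A A).hom ≫ D ◁ ((tr ⊗ₘ tr) ≫ (λ_ _).hom) := by
    simp [MonoidalCategory.tensorHom_def']
  have h' : (β_ A A).hom ≫ (tr ⊗ₘ tr) = (tr ⊗ₘ tr) := by
    rw [← BraidedCategory.braiding_naturality]
    simp [← unitors_equal]
  have h'' : swapLast D A ≫ ((D ⊗ A) ◁ tr ≫ (ρ_ _).hom) ≫ D ◁ tr =
      ((D ⊗ A) ◁ tr ≫ (ρ_ _).hom) ≫ D ◁ tr := by
    rw [h, swapLast]
    simp only [Category.assoc, Iso.inv_hom_id_assoc]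
    rw [← MonoidalCategory.whiskerLeft_comp, reassoc_of% h']
  ext
  simp only [integral_hom, map_hom, Category.assoc] at h'' ⊢
  rw [reassoc_of% h'']

/-- The copairing is supported on the diagonal. -/
lemma copairing_mul {tr : A ⟶ 𝟙_ T} {c : 𝟙_ T ⟶ A ⊗ A} (h : EtalePairing tr c)
    (u : Points (A ⊗ A)) : (⟨c⟩ : Points (A ⊗ A)) * u = ⟨c⟩ * map (inr A A) (map μ u) := by
  ext
  have h1 : desc c (𝟙 (A ⊗ A)) = desc c (μ ≫ inr A A) := h.desc_id
  have h2 := congr((𝟙 _ ⊗ₘ u.hom) ≫ $h1)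
  rw [tensorHom_desc, tensorHom_desc] at h2
  simpa [mul_hom] using h2

/-- The copairing is the Dirac distribution of the diagonal. -/
lemma integral_copairing_mul {tr : A ⟶ 𝟙_ T} {c : 𝟙_ T ⟶ A ⊗ A} (h : EtalePairing tr c)
    (x : Points A) : integral tr ((⟨c⟩ : Points (A ⊗ A)) * map (inr A A) x) = x := by
  have h1 : desc c (inr A A) = c ▷ A ≫ (α_ A A A).hom ≫ A ◁ μ := by
    rw [← desc_id_inr, ← tensorHom_id, tensorHom_desc, Category.id_comp, Category.comp_id]
  have h2 : desc c (x.hom ≫ inr A A) = 𝟙_ T ◁ x.hom ≫ desc c (inr A A) := by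
    rw [← id_tensorHom, tensorHom_desc, Category.id_comp]
  have h3 := h.zigzag_right
  rw [MonoidalCategory.whiskerLeft_comp] at h3
  ext
  rw [integral_hom, mul_hom, map_hom]
  simp only
  rw [h2, h1]
  simp only [Category.assoc]
  rw [reassoc_of% h3]
  simp

end Points

end Points

/-! ### Points of an étale algebra form a reduced ring -/

section Reduced

variable {T : Type u} [Category.{v} T] [Abelian T] [MonoidalCategory T] [SymmetricCategory T]
  [MonoidalPreadditive T] [RigidCategory T]

/-- A point of square zero of an étale algebra vanishes. Multiplication by it factors as `π ≫ ι`
through its image `ι`, on which every multiple of it vanishes, so by cyclicity of the trace the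
multiples of the point have trace zero: the point is orthogonal to everything for the trace
pairing. -/
lemma IsEtale.eq_zero_of_mul_self {D : T} [MonObj D] [IsCommMonObj D] (h : IsEtale D)
    (y : Points D) (hy : y * y = 0) : y = 0 := by
  set L := y.mulHom with hL
  have hLL : L ≫ L = 0 := by rw [hL, ← Points.mulHom_mul, hy, Points.mulHom_zero]
  have hfac : factorThruImage L ≫ image.ι L = L := image.fac L
  have h0 : image.ι L ≫ L = 0 := by
    rw [← cancel_epi (factorThruImage L), reassoc_of% hfac, hLL, comp_zero]
  have h1 : D ◁ image.ι L ≫ μ ≫ factorThruImage L = 0 := by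
    rw [← cancel_mono (image.ι L)]
    simp only [Category.assoc, hfac, zero_comp]
    rw [hL, Points.mul_comp_mulHom_right, ← MonoidalCategory.whiskerLeft_comp_assoc, ← hL, h0]
    simp
  have h2 : L ≫ algTrace D = 0 := by
    have e1 : L ≫ algTrace D = partialTrace D (L ▷ D ≫ μ) := by
      simp only [algTrace, partialTrace, comp_whiskerRight, Category.assoc]
      rw [← associator_inv_naturality_left_assoc, whisker_exchange_assoc,
        rightUnitor_inv_naturality_assoc]
    rw [e1, hL, ← Points.mul_comp_mulHom_left, ← hL, ← hfac, ← Category.assoc, partialTrace_comp, h1]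
    simp [partialTrace]
  obtain ⟨e, he⟩ := h
  have h3 : D ◁ y.hom ≫ μ ≫ algTrace D = 0 := by
    have : D ◁ y.hom ≫ μ = (ρ_ D).hom ≫ L := by
      rw [hL, Points.mulHom, ← braiding_desc]
      simp [desc]
    rw [reassoc_of% this, h2, comp_zero]
  ext
  rw [eq_of_exactPairing e he y.hom, h3]
  simp

lemma IsEtale.isReduced_points {D : T} [MonObj D] [IsCommMonObj D] (h : IsEtale D) :
    IsReduced (Points D) :=
  (isReduced_iff_pow_one_lt 2 one_lt_two).2 fun y hy => h.eq_zero_of_mul_self y (by rw [← sq, hy])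

end Reduced

/-! ### Direct factors of algebras -/

section Factor

variable {T : Type u} [Category.{v} T] [MonoidalCategory T] [SymmetricCategory T]

/-- `M` is a direct factor of the algebra `D`, that is `D = M × N` for some algebra `N`: there is
an algebra homomorphism `p : D ⟶ M` with a section `i` which is `D`-linear (extension by zero). -/
structure IsFactor {D M : T} [MonObj D] [MonObj M] (i : M ⟶ D) (p : D ⟶ M) : Prop where
  isMonHom : IsMonHom p
  comp_eq_id : i ≫ p = 𝟙 M
  whiskerLeft_mul : D ◁ i ≫ μ = p ▷ M ≫ μ ≫ i

variable {D M N : T} [MonObj D] [MonObj M] [MonObj N] {i : M ⟶ D} {p : D ⟶ M} {j : N ⟶ D}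
  {q : D ⟶ N}

lemma IsFactor.whiskerRight_mul [IsCommMonObj D] [IsCommMonObj M] (h : IsFactor i p) :
    i ▷ D ≫ μ = M ◁ p ≫ μ ≫ i := by
  rw [← IsCommMonObj.mul_comm D, BraidedCategory.braiding_naturality_left_assoc, h.whiskerLeft_mul,
    ← BraidedCategory.braiding_naturality_right_assoc, IsCommMonObj.mul_comm_assoc]

lemma IsFactor.tensorHom_mul (h : IsFactor i p) : (i ⊗ₘ i) ≫ μ = μ ≫ i := by
  rw [MonoidalCategory.tensorHom_def, Category.assoc, h.whiskerLeft_mul,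
    ← comp_whiskerRight_assoc, h.comp_eq_id, id_whiskerRight, Category.id_comp]

lemma IsFactor.trans {L : T} [MonObj L] {i' : L ⟶ M} {p' : M ⟶ L} (h : IsFactor i p)
    (h' : IsFactor i' p') : IsFactor (i' ≫ i) (p ≫ p') where
  isMonHom := by
    have := h.isMonHom
    have := h'.isMonHom
    infer_instance
  comp_eq_id := by rw [Category.assoc, reassoc_of% h.comp_eq_id, h'.comp_eq_id]
  whiskerLeft_mul := by
    rw [MonoidalCategory.whiskerLeft_comp, Category.assoc, h.whiskerLeft_mul,
      whisker_exchange_assoc, reassoc_of% h'.whiskerLeft_mul, comp_whiskerRight, Category.assoc]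

lemma IsFactor.of_inverse (f : M ⟶ D) (g : D ⟶ M) [IsMonHom g] (hfg : f ≫ g = 𝟙 M)
    (hgf : g ≫ f = 𝟙 D) : IsFactor f g where
  isMonHom := inferInstance
  comp_eq_id := hfg
  whiskerLeft_mul := by
    have : D ◁ f ≫ μ ≫ g = g ▷ M ≫ μ := by
      rw [IsMonHom.mul_hom, MonoidalCategory.tensorHom_def', Category.assoc,
        ← MonoidalCategory.whiskerLeft_comp_assoc, hfg]
      simp
    rw [← reassoc_of% this, hgf, Category.comp_id]

/-- Adjointness of extension by zero and restriction: contracting the second component `C₂` of `C`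
with `i x` for the form `tr (_ * _)` of `D` is contracting `p C₂` with `x` for the induced form
of `M`. -/
lemma zigzag_right_of_isFactor [IsCommMonObj D] [IsCommMonObj M] (h : IsFactor i p)
    {trM : M ⟶ 𝟙_ T} {tr : D ⟶ 𝟙_ T} (htr : i ≫ tr = trM) (C : 𝟙_ T ⟶ D ⊗ D) :
    i ≫ (λ_ D).inv ≫ C ▷ D ≫ (α_ D D D).hom ≫ D ◁ (μ ≫ tr) =
      (λ_ M).inv ≫ (C ≫ D ◁ p) ▷ M ≫ (α_ D M M).hom ≫ D ◁ (μ ≫ trM) := by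
  subst htr
  have : (C ≫ D ◁ p) ▷ M ≫ (α_ D M M).hom ≫ D ◁ (μ ≫ i ≫ tr) =
      C ▷ M ≫ (α_ D D M).hom ≫ D ◁ (p ▷ M ≫ μ ≫ i ≫ tr) := by
    simp
  rw [this, ← reassoc_of% h.whiskerLeft_mul, leftUnitor_inv_naturality_assoc, whisker_exchange_assoc]
  simp

/-- The mirror image of `zigzag_right_of_isFactor`. -/
lemma zigzag_left_of_isFactor [IsCommMonObj D] [IsCommMonObj M] (h : IsFactor i p)
    {trM : M ⟶ 𝟙_ T} {tr : D ⟶ 𝟙_ T} (htr : i ≫ tr = trM) (C : 𝟙_ T ⟶ D ⊗ D) :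
    i ≫ (ρ_ D).inv ≫ D ◁ C ≫ (α_ D D D).inv ≫ (μ ≫ tr) ▷ D =
      (ρ_ M).inv ≫ M ◁ (C ≫ p ▷ D) ≫ (α_ M M D).inv ≫ (μ ≫ trM) ▷ D := by
  subst htr
  have : M ◁ (C ≫ p ▷ D) ≫ (α_ M M D).inv ≫ (μ ≫ i ≫ tr) ▷ D =
      M ◁ C ≫ (α_ M D D).inv ≫ (M ◁ p ≫ μ ≫ i ≫ tr) ▷ D := by
    simp
  rw [this, ← reassoc_of% h.whiskerRight_mul, rightUnitor_inv_naturality_assoc,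
    ← whisker_exchange_assoc]
  simp

/-- A direct factor of an étale algebra is étale. -/
lemma EtalePairing.factor [IsCommMonObj D] [IsCommMonObj M] (h : IsFactor i p)
    {tr : D ⟶ 𝟙_ T} {c : 𝟙_ T ⟶ D ⊗ D} (hc : EtalePairing tr c) :
    EtalePairing (i ≫ tr) (c ≫ (p ⊗ₘ p)) where
  zigzag_left := by
    have h1 := zigzag_left_of_isFactor h (tr := tr) rfl c
    rw [hc.zigzag_left, Iso.inv_hom_id_assoc] at h1
    have h2 := congr($h1 ≫ 𝟙_ T ◁ p)
    rw [Category.assoc, ← leftUnitor_inv_naturality, reassoc_of% h.comp_eq_id] at h2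
    rw [← cancel_epi (ρ_ M).inv, Iso.inv_hom_id_assoc, h2]
    simp only [Category.assoc]
    rw [← whisker_exchange, MonoidalCategory.tensorHom_def]
    simp
  zigzag_right := by
    have h1 := zigzag_right_of_isFactor h (tr := tr) rfl c
    rw [hc.zigzag_right, Iso.inv_hom_id_assoc] at h1
    have h2 := congr($h1 ≫ p ▷ 𝟙_ T)
    rw [Category.assoc, ← rightUnitor_inv_naturality, reassoc_of% h.comp_eq_id] at h2
    rw [← cancel_epi (λ_ M).inv, Iso.inv_hom_id_assoc, h2]
    simp only [Category.assoc]
    rw [whisker_exchange, MonoidalCategory.tensorHom_def']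
    simp
  comp_mul := by
    have := h.isMonHom
    rw [Category.assoc, ← IsMonHom.mul_hom, reassoc_of% hc.comp_mul, IsMonHom.one_hom]

variable [Preadditive T] [MonoidalPreadditive T]

/-- If an algebra is the product of two étale algebras, it is étale. -/
lemma EtalePairing.of_isFactor [IsCommMonObj D] [IsCommMonObj M] [IsCommMonObj N]
    (h : IsFactor i p) (h' : IsFactor j q) (hiq : i ≫ q = 0) (hjp : j ≫ p = 0)
    (hid : p ≫ i + q ≫ j = 𝟙 D)
    {tr : M ⟶ 𝟙_ T} {c : 𝟙_ T ⟶ M ⊗ M} (hc : EtalePairing tr c)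
    {tr' : N ⟶ 𝟙_ T} {c' : 𝟙_ T ⟶ N ⊗ N} (hc' : EtalePairing tr' c') :
    EtalePairing (p ≫ tr + q ≫ tr') (c ≫ (i ⊗ₘ i) + c' ≫ (j ⊗ₘ j)) where
  zigzag_left := by
    have hM := zigzag_left_of_isFactor h (tr := p ≫ tr + q ≫ tr') (trM := tr)
      (by simp [reassoc_of% h.comp_eq_id, reassoc_of% hiq]) (c ≫ (i ⊗ₘ i) + c' ≫ (j ⊗ₘ j))
    have hN := zigzag_left_of_isFactor h' (tr := p ≫ tr + q ≫ tr') (trM := tr')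
      (by simp [reassoc_of% h'.comp_eq_id, reassoc_of% hjp]) (c ≫ (i ⊗ₘ i) + c' ≫ (j ⊗ₘ j))
    have e1 : (c ≫ (i ⊗ₘ i) + c' ≫ (j ⊗ₘ j)) ≫ p ▷ D = c ≫ M ◁ i := by
      simp [← tensorHom_id, ← id_tensorHom, h.comp_eq_id, hjp]
    have e2 : (c ≫ (i ⊗ₘ i) + c' ≫ (j ⊗ₘ j)) ≫ q ▷ D = c' ≫ N ◁ j := by
      simp [← tensorHom_id, ← id_tensorHom, h'.comp_eq_id, hiq]
    rw [e1, MonoidalCategory.whiskerLeft_comp, Category.assoc,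
      associator_inv_naturality_right_assoc, whisker_exchange, reassoc_of% hc.zigzag_left,
      Iso.inv_hom_id_assoc, ← leftUnitor_inv_naturality] at hM
    rw [e2, MonoidalCategory.whiskerLeft_comp, Category.assoc,
      associator_inv_naturality_right_assoc, whisker_exchange, reassoc_of% hc'.zigzag_left,
      Iso.inv_hom_id_assoc, ← leftUnitor_inv_naturality] at hN
    rw [← cancel_epi (ρ_ D).inv, Iso.inv_hom_id_assoc, ← Category.id_comp ((ρ_ D).inv ≫ _), ← hid,
      Preadditive.add_comp, Category.assoc, Category.assoc, hM, hN, ← Category.assoc,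
      ← Category.assoc, ← Preadditive.add_comp, hid, Category.id_comp]
  zigzag_right := by
    have hM := zigzag_right_of_isFactor h (tr := p ≫ tr + q ≫ tr') (trM := tr)
      (by simp [reassoc_of% h.comp_eq_id, reassoc_of% hiq]) (c ≫ (i ⊗ₘ i) + c' ≫ (j ⊗ₘ j))
    have hN := zigzag_right_of_isFactor h' (tr := p ≫ tr + q ≫ tr') (trM := tr')
      (by simp [reassoc_of% h'.comp_eq_id, reassoc_of% hjp]) (c ≫ (i ⊗ₘ i) + c' ≫ (j ⊗ₘ j))
    have e1 : (c ≫ (i ⊗ₘ i) + c' ≫ (j ⊗ₘ j)) ≫ D ◁ p = c ≫ i ▷ M := by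
      simp [← tensorHom_id, ← id_tensorHom, h.comp_eq_id, hjp]
    have e2 : (c ≫ (i ⊗ₘ i) + c' ≫ (j ⊗ₘ j)) ≫ D ◁ q = c' ≫ j ▷ N := by
      simp [← tensorHom_id, ← id_tensorHom, h'.comp_eq_id, hiq]
    rw [e1, comp_whiskerRight, Category.assoc, associator_naturality_left_assoc,
      ← whisker_exchange, reassoc_of% hc.zigzag_right, Iso.inv_hom_id_assoc,
      ← rightUnitor_inv_naturality] at hM
    rw [e2, comp_whiskerRight, Category.assoc, associator_naturality_left_assoc,
      ← whisker_exchange, reassoc_of% hc'.zigzag_right, Iso.inv_hom_id_assoc,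
      ← rightUnitor_inv_naturality] at hN
    rw [← cancel_epi (λ_ D).inv, Iso.inv_hom_id_assoc, ← Category.id_comp ((λ_ D).inv ≫ _), ← hid,
      Preadditive.add_comp, Category.assoc, Category.assoc, hM, hN, ← Category.assoc,
      ← Category.assoc, ← Preadditive.add_comp, hid, Category.id_comp]
  comp_mul := by
    have := h.isMonHom
    have := h'.isMonHom
    rw [Preadditive.add_comp, Category.assoc, Category.assoc, h.tensorHom_mul,
      h'.tensorHom_mul, reassoc_of% hc.comp_mul,
      reassoc_of% hc'.comp_mul, ← IsMonHom.one_hom p, ← IsMonHom.one_hom q, Category.assoc,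
      Category.assoc, ← Preadditive.comp_add, hid, Category.comp_id]

end Factor

/-! ### Products of algebras -/

section Product

variable {T : Type u} [Category.{v} T] [MonoidalCategory T] [SymmetricCategory T]
  [Preadditive T] [MonoidalPreadditive T] [HasBinaryBiproducts T]
  (M N : T) [MonObj M] [MonObj N]

/-- The product of two algebras: the direct sum with componentwise multiplication. -/
noncomputable instance prodMonObj : MonObj (M ⊞ N) where
  one := biprod.lift η η
  mul := biprod.lift ((biprod.fst ⊗ₘ biprod.fst) ≫ μ) ((biprod.snd ⊗ₘ biprod.snd) ≫ μ)
  one_mul := by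
    ext <;> simp [← tensorHom_id]
  mul_one := by
    ext <;> simp [← id_tensorHom]
  mul_assoc := by
    ext <;> simp [← id_tensorHom, ← tensorHom_id] <;> simp only [mon_tauto]

instance : IsMonHom (biprod.fst : M ⊞ N ⟶ M) where
  one_hom := biprod.lift_fst _ _
  mul_hom := biprod.lift_fst _ _

instance : IsMonHom (biprod.snd : M ⊞ N ⟶ N) where
  one_hom := biprod.lift_snd _ _
  mul_hom := biprod.lift_snd _ _

instance [IsCommMonObj M] [IsCommMonObj N] : IsCommMonObj (M ⊞ N) where
  mul_comm := by
    ext <;> simp [← BraidedCategory.braiding_naturality_assoc]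

lemma isFactor_inl_fst : IsFactor (biprod.inl : M ⟶ M ⊞ N) biprod.fst where
  isMonHom := inferInstance
  comp_eq_id := by simp
  whiskerLeft_mul := by
    ext <;> simp [← id_tensorHom, ← tensorHom_id]

lemma isFactor_inr_snd : IsFactor (biprod.inr : N ⟶ M ⊞ N) biprod.snd where
  isMonHom := inferInstance
  comp_eq_id := by simp
  whiskerLeft_mul := by
    ext <;> simp [← id_tensorHom, ← tensorHom_id]

end Product

/-! ### Direct factors and idempotents -/

section Splitting

variable {T : Type u} [Category.{v} T] [MonoidalCategory T] [SymmetricCategory T]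
  [Preadditive T] [MonoidalPreadditive T] {D : T} [MonObj D] [IsCommMonObj D]

/-- The projection to a direct factor, followed by extension by zero, is the multiplication with
an idempotent: the extension by zero of `1`. -/
lemma IsFactor.comp_eq_mulHom {M : T} [MonObj M] {i : M ⟶ D} {p : D ⟶ M} (h : IsFactor i p) :
    p ≫ i = Points.mulHom ⟨η ≫ i⟩ := by
  have h1 : desc (𝟙 D) (η ≫ i) = (ρ_ D).hom ≫ p ≫ i := by
    rw [desc, id_tensorHom, MonoidalCategory.whiskerLeft_comp, Category.assoc, h.whiskerLeft_mul,
      whisker_exchange_assoc, MonObj.mul_one_assoc, rightUnitor_naturality_assoc]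
  rw [Points.mulHom, ← braiding_desc, h1]
  simp

/-- An idempotent point of a commutative algebra cuts out a direct factor. -/
lemma exists_isFactor [IsIdempotentComplete T] (e : Points D) (he : e * e = e) :
    ∃ (M : T) (_ : MonObj M) (_ : IsCommMonObj M) (i : M ⟶ D) (p : D ⟶ M),
      IsFactor i p ∧ p ≫ i = e.mulHom := by
  obtain ⟨M, i, p, hip, hpi⟩ := IsIdempotentComplete.idempotents_split D e.mulHom
    (by rw [← Points.mulHom_mul, he])
  have hp : e.mulHom ≫ p = p := by rw [← hpi, Category.assoc, hip, Category.comp_id]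
  have hi : i ≫ e.mulHom = i := by rw [← hpi, reassoc_of% hip]
  have hl {X Y : T} (f : X ⟶ M) (g : Y ⟶ M) : (f ⊗ₘ g) ≫ desc i i = desc (f ≫ i) (g ≫ i) :=
    tensorHom_desc _ _ _ _
  let _ : MonObj M :=
    { one := η ≫ p
      mul := desc i i ≫ p
      one_mul := by
        rw [← tensorHom_id, reassoc_of% hl, Category.assoc, hpi, Category.id_comp,
          Points.one_comp_mulHom, Points.desc_hom_left, hi, Category.assoc, hip, Category.comp_id]
      mul_one := by
        rw [← id_tensorHom, reassoc_of% hl, Category.assoc, hpi, Category.id_comp,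
          Points.one_comp_mulHom, Points.desc_hom_right, hi, Category.assoc, hip, Category.comp_id]
      mul_assoc := by
        rw [← id_tensorHom, ← tensorHom_id, reassoc_of% hl, reassoc_of% hl, Category.assoc, hpi,
          Category.id_comp, ← Points.desc_comp_mulHom_left, ← Points.desc_comp_mulHom_right,
          Category.assoc, Category.assoc, hp, desc_assoc, Category.assoc] }
  have : IsCommMonObj M :=
    ⟨by change (β_ M M).hom ≫ desc i i ≫ p = desc i i ≫ p; rw [← Category.assoc, braiding_desc]⟩
  refine ⟨M, inferInstance, inferInstance, i, p, ⟨⟨rfl, ?_⟩, hip, ?_⟩, hpi⟩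
  · change μ ≫ p = (p ⊗ₘ p) ≫ desc i i ≫ p
    rw [reassoc_of% hl, hpi]
    have := Points.desc_comp_mulHom_left e (𝟙 D) e.mulHom
    rw [Category.id_comp] at this
    rw [← this, ← Category.id_comp e.mulHom, ← Points.desc_comp_mulHom_right]
    simp [hp, desc]
  · change D ◁ i ≫ μ = p ▷ M ≫ (desc i i ≫ p) ≫ i
    rw [← tensorHom_id, Category.assoc, hpi, reassoc_of% hl, hpi, Points.desc_comp_mulHom_right,
      Category.assoc, hi, Category.id_comp]
    have := Points.desc_comp_mulHom_left e (𝟙 D) i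
    rw [Category.id_comp, Points.desc_comp_mulHom_right, hi] at this
    rw [← this, desc, id_tensorHom]

end Splitting

/-! ### The square of an étale algebra in the opposite category -/

section Total

/-- Totality of a relation can be tested with any product `X × X`. -/
lemma BinaryRelation.IsTotal.existsUnique {S : Type u} [Category.{v} S] {X : S}
    {r : BinaryRelation X} (hr : r.IsTotal) {P : BinaryFan X X} (hP : IsLimit P)
    (Z : S) (f : r.R ⟶ Z) (g : X ⟶ Z) (h : r.R ⟶ Z) :
    ∃! l : P.pt ⟶ Z,
      hP.lift (BinaryFan.mk r.p r.q) ≫ l = f ∧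
      hP.lift (BinaryFan.mk (𝟙 X) (𝟙 X)) ≫ l = g ∧
      hP.lift (BinaryFan.mk r.q r.p) ≫ l = h := by
  obtain ⟨P', hP', H⟩ := hr
  let e : P'.pt ≅ P.pt := hP'.conePointUniqueUpToIso hP
  have he (s : BinaryFan X X) : hP'.lift s ≫ e.hom = hP.lift s :=
    hP'.lift_comp_conePointUniqueUpToIso_hom hP
  obtain ⟨l, hl, hu⟩ := H Z f g h
  simp only [← he, Category.assoc]
  refine ⟨e.inv ≫ l, by simpa using hl, fun l' hl' => ?_⟩
  rw [← hu (e.hom ≫ l') hl', Iso.inv_hom_id_assoc]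

variable {T : Type u} [Category.{v} T] [MonoidalCategory T] [SymmetricCategory T]
  [RigidCategory T]

/-- The object of the category of étale algebras given by an étale algebra. -/
abbrev EtaleAlg.of (D : T) [MonObj D] [IsCommMonObj D] (h : IsEtale D) : EtaleAlg T :=
  ⟨⟨D⟩, h⟩

/-- The morphism of étale algebras given by an algebra homomorphism. -/
def EtaleAlg.ofHom {X Y : EtaleAlg T} (f : X.obj.X ⟶ Y.obj.X) [h : IsMonHom f] : X ⟶ Y :=
  ObjectProperty.homMk (CommMon.homMk (@Mon.Hom.mk _ _ _ X.obj.toMon Y.obj.toMon f h))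

/-- The algebra homomorphism underlying a morphism of étale algebras. -/
def EtaleAlg.toHom {X Y : EtaleAlg T} (f : X ⟶ Y) : X.obj.X ⟶ Y.obj.X := f.hom.hom.hom

instance {X Y : EtaleAlg T} (f : X ⟶ Y) : IsMonHom (EtaleAlg.toHom f) :=
  f.hom.hom.isMonHom_hom

lemma EtaleAlg.hom_ext {X Y : EtaleAlg T} {f g : X ⟶ Y}
    (h : EtaleAlg.toHom f = EtaleAlg.toHom g) : f = g :=
  ObjectProperty.hom_ext _ (CommMon.hom_ext _ _ h)

lemma IsEtale.tensor {M N : T} [MonObj M] [IsCommMonObj M] [MonObj N] [IsCommMonObj N]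
    (h : IsEtale M) (h' : IsEtale N) : IsEtale (M ⊗ N) := by
  obtain ⟨c, hc⟩ := h.exists_etalePairing
  obtain ⟨c', hc'⟩ := h'.exists_etalePairing
  exact (hc.tensor hc').isEtale

lemma IsEtale.factor {D M : T} [MonObj D] [IsCommMonObj D] [MonObj M] [IsCommMonObj M]
    {i : M ⟶ D} {p : D ⟶ M} (h : IsEtale D) (hip : IsFactor i p) : IsEtale M := by
  obtain ⟨c, hc⟩ := h.exists_etalePairing
  exact (hc.factor hip).isEtale

lemma IsEtale.prod [Preadditive T] [MonoidalPreadditive T] [HasBinaryBiproducts T] {M N : T}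
    [MonObj M] [IsCommMonObj M] [MonObj N] [IsCommMonObj N]
    (h : IsEtale M) (h' : IsEtale N) : IsEtale (M ⊞ N) := by
  obtain ⟨c, hc⟩ := h.exists_etalePairing
  obtain ⟨c', hc'⟩ := h'.exists_etalePairing
  exact (EtalePairing.of_isFactor (isFactor_inl_fst M N) (isFactor_inr_snd M N) (by simp) (by simp)
    biprod.total hc hc').isEtale

/-- The tensor square of an étale algebra, as a binary fan in the opposite category. -/
abbrev tensorFan (X : (EtaleAlg T)ᵒᵖ) : BinaryFan X X :=
  BinaryFan.mk
    (P := Opposite.op (EtaleAlg.of (X.unop.obj.X ⊗ X.unop.obj.X)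
      (X.unop.property.tensor X.unop.property)))
    (EtaleAlg.ofHom (X := X.unop) (inl X.unop.obj.X X.unop.obj.X)).op
    (EtaleAlg.ofHom (X := X.unop) (inr X.unop.obj.X X.unop.obj.X)).op

/-- The morphism to the tensor square in the opposite category with given components. -/
abbrev tensorFanLift {X Z : (EtaleAlg T)ᵒᵖ} (f g : Z ⟶ X) : Z ⟶ (tensorFan X).pt :=
  (EtaleAlg.ofHom (X := EtaleAlg.of (X.unop.obj.X ⊗ X.unop.obj.X)
      (X.unop.property.tensor X.unop.property)) (Y := Z.unop)
    (desc (EtaleAlg.toHom f.unop) (EtaleAlg.toHom g.unop))).op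

lemma tensorFanLift_fst {X Z : (EtaleAlg T)ᵒᵖ} (f g : Z ⟶ X) :
    tensorFanLift f g ≫ (tensorFan X).fst = f :=
  Quiver.Hom.unop_inj (EtaleAlg.hom_ext
    (by exact inl_desc (EtaleAlg.toHom f.unop) (EtaleAlg.toHom g.unop)))

lemma tensorFanLift_snd {X Z : (EtaleAlg T)ᵒᵖ} (f g : Z ⟶ X) :
    tensorFanLift f g ≫ (tensorFan X).snd = g :=
  Quiver.Hom.unop_inj (EtaleAlg.hom_ext
    (by exact inr_desc (EtaleAlg.toHom f.unop) (EtaleAlg.toHom g.unop)))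

/-- The tensor square of an étale algebra is its product with itself in the opposite category. -/
def tensorFanIsLimit (X : (EtaleAlg T)ᵒᵖ) : IsLimit (tensorFan X) :=
  BinaryFan.isLimitMk
    (fun s => tensorFanLift (X := X) (Z := s.pt) s.fst s.snd)
    (fun s => tensorFanLift_fst (X := X) (Z := s.pt) s.fst s.snd)
    (fun s => tensorFanLift_snd (X := X) (Z := s.pt) s.fst s.snd)
    (fun s m h₁ h₂ => Quiver.Hom.unop_inj (EtaleAlg.hom_ext (by
      have e₁ := congr(EtaleAlg.toHom (Quiver.Hom.unop $h₁))
      have e₂ := congr(EtaleAlg.toHom (Quiver.Hom.unop $h₂))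
      refine (eq_desc (EtaleAlg.toHom m.unop)).trans ?_
      exact congr(desc $e₁ $e₂))))

variable (A : OrderedEtaleAlg T)

namespace OrderedEtaleAlg

/-- The object of functions on the order relation `{x < y}`. -/
abbrev rel : T := A.lt.R.unop.obj.X

/-- The pullback of functions along the first projection of the order relation. -/
abbrev pr₁ : A.alg.X ⟶ A.rel := EtaleAlg.toHom A.lt.p.unop

/-- The pullback of functions along the second projection of the order relation. -/
abbrev pr₂ : A.alg.X ⟶ A.rel := EtaleAlg.toHom A.lt.q.unop

lemma isEtale_alg : IsEtale A.alg.X := A.obj.unop.property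

lemma isEtale_rel : IsEtale A.rel := A.lt.R.unop.property

/-- The universal property of the tensor square expressing totality of the order: existence. -/
lemma exists_hom_tensor {Z : T} [MonObj Z] [IsCommMonObj Z] (hZ : IsEtale Z)
    (f : Z ⟶ A.rel) (g : Z ⟶ A.alg.X) (h : Z ⟶ A.rel) [IsMonHom f] [IsMonHom g] [IsMonHom h] :
    ∃ l : Z ⟶ A.alg.X ⊗ A.alg.X, IsMonHom l ∧ l ≫ desc A.pr₁ A.pr₂ = f ∧ l ≫ μ = g ∧
      l ≫ desc A.pr₂ A.pr₁ = h := by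
  obtain ⟨l, ⟨h1, h2, h3⟩, -⟩ := A.total.existsUnique (tensorFanIsLimit A.obj)
    (Opposite.op (EtaleAlg.of Z hZ)) (EtaleAlg.ofHom (X := EtaleAlg.of Z hZ) f).op
    (EtaleAlg.ofHom (X := EtaleAlg.of Z hZ) g).op (EtaleAlg.ofHom (X := EtaleAlg.of Z hZ) h).op
  refine ⟨EtaleAlg.toHom l.unop, inferInstance, congr(EtaleAlg.toHom (Quiver.Hom.unop $h1)), ?_,
    congr(EtaleAlg.toHom (Quiver.Hom.unop $h3))⟩
  have : EtaleAlg.toHom l.unop ≫ desc (𝟙 _) (𝟙 _) = g :=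
    congr(EtaleAlg.toHom (Quiver.Hom.unop $h2))
  simpa [desc] using this

/-- The universal property of the tensor square expressing totality of the order: uniqueness. -/
lemma hom_tensor_ext {Z : T} [MonObj Z] [IsCommMonObj Z] (hZ : IsEtale Z)
    (l l' : Z ⟶ A.alg.X ⊗ A.alg.X) [IsMonHom l] [IsMonHom l']
    (h₁ : l ≫ desc A.pr₁ A.pr₂ = l' ≫ desc A.pr₁ A.pr₂) (h₂ : l ≫ μ = l' ≫ μ)
    (h₃ : l ≫ desc A.pr₂ A.pr₁ = l' ≫ desc A.pr₂ A.pr₁) : l = l' := by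
  have hd : desc (𝟙 A.alg.X) (𝟙 A.alg.X) = μ := by simp [desc]
  let Q := EtaleAlg.of (A.alg.X ⊗ A.alg.X) (A.isEtale_alg.tensor A.isEtale_alg)
  have := (A.total.existsUnique (tensorFanIsLimit A.obj)
    (Opposite.op (EtaleAlg.of Z hZ))
    (EtaleAlg.ofHom (X := EtaleAlg.of Z hZ) (l ≫ desc A.pr₁ A.pr₂)).op
    (EtaleAlg.ofHom (X := EtaleAlg.of Z hZ) (l ≫ μ)).op
    (EtaleAlg.ofHom (X := EtaleAlg.of Z hZ) (l ≫ desc A.pr₂ A.pr₁)).op).unique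
      (y₁ := (EtaleAlg.ofHom (X := EtaleAlg.of Z hZ) (Y := Q) l).op)
      (y₂ := (EtaleAlg.ofHom (X := EtaleAlg.of Z hZ) (Y := Q) l').op)
      ⟨rfl, Quiver.Hom.unop_inj (EtaleAlg.hom_ext congr(l ≫ $hd)), rfl⟩
      ⟨Quiver.Hom.unop_inj (EtaleAlg.hom_ext h₁.symm),
        Quiver.Hom.unop_inj (EtaleAlg.hom_ext (congr(l' ≫ $hd).trans h₂.symm)),
        Quiver.Hom.unop_inj (EtaleAlg.hom_ext h₃.symm)⟩
  exact congr(EtaleAlg.toHom (Quiver.Hom.unop $this))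

end OrderedEtaleAlg

end Total

/-! ### The decomposition of the square of an ordered étale algebra -/

section Decomposition

variable {T : Type u} [Category.{v} T] [Abelian T] [MonoidalCategory T] [SymmetricCategory T]
  [MonoidalPreadditive T] [RigidCategory T] (A : OrderedEtaleAlg T)

namespace OrderedEtaleAlg

/-- The square `X × X` of an ordered object is the disjoint union of `{x < y}`, the diagonal and
`{y < x}`: the three restriction maps of functions exhibit the tensor square as a product. -/
lemma exists_decomposition : ∃ (s₁ : A.rel ⟶ A.alg.X ⊗ A.alg.X)
    (s₂ : A.alg.X ⟶ A.alg.X ⊗ A.alg.X) (s₃ : A.rel ⟶ A.alg.X ⊗ A.alg.X),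
    (IsFactor s₁ (desc A.pr₁ A.pr₂) ∧ s₁ ≫ μ = 0 ∧ s₁ ≫ desc A.pr₂ A.pr₁ = 0) ∧
    (IsFactor s₂ μ ∧ s₂ ≫ desc A.pr₁ A.pr₂ = 0 ∧ s₂ ≫ desc A.pr₂ A.pr₁ = 0) ∧
    (IsFactor s₃ (desc A.pr₂ A.pr₁) ∧ s₃ ≫ desc A.pr₁ A.pr₂ = 0 ∧ s₃ ≫ μ = 0) ∧
    desc A.pr₁ A.pr₂ ≫ s₁ + μ ≫ s₂ + desc A.pr₂ A.pr₁ ≫ s₃ = 𝟙 _ := by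
  have hQ : IsEtale ((A.rel ⊞ A.alg.X) ⊞ A.rel) :=
    (A.isEtale_rel.prod A.isEtale_alg).prod A.isEtale_rel
  obtain ⟨φ, hφ, h₁, h₂, h₃⟩ := A.exists_hom_tensor hQ (biprod.fst ≫ biprod.fst)
    (biprod.fst ≫ biprod.snd) biprod.snd
  let ψ : A.alg.X ⊗ A.alg.X ⟶ (A.rel ⊞ A.alg.X) ⊞ A.rel :=
    biprod.lift (biprod.lift (desc A.pr₁ A.pr₂) μ) (desc A.pr₂ A.pr₁)
  have hφψ : φ ≫ ψ = 𝟙 _ := by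
    ext <;> simp [ψ, h₁, h₂, h₃]
  have : IsMonHom ψ :=
    { one_hom := by ext <;> simp [ψ]
      mul_hom := by ext <;> simp [ψ] }
  have hψφ : ψ ≫ φ = 𝟙 _ := by
    apply A.hom_tensor_ext (A.isEtale_alg.tensor A.isEtale_alg)
    · rw [Category.assoc, h₁, Category.id_comp]; simp [ψ]
    · rw [Category.assoc, h₂, Category.id_comp]; simp [ψ]
    · rw [Category.assoc, h₃, Category.id_comp]; simp [ψ]
  have hiso := IsFactor.of_inverse φ ψ hφψ hψφ
  have f₁ := hiso.trans ((isFactor_inl_fst (A.rel ⊞ A.alg.X) A.rel).trans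
    (isFactor_inl_fst A.rel A.alg.X))
  have f₂ := hiso.trans ((isFactor_inl_fst (A.rel ⊞ A.alg.X) A.rel).trans
    (isFactor_inr_snd A.rel A.alg.X))
  have f₃ := hiso.trans (isFactor_inr_snd (A.rel ⊞ A.alg.X) A.rel)
  have e₁ : ψ ≫ biprod.fst ≫ biprod.fst = desc A.pr₁ A.pr₂ := by simp [ψ]
  have e₂ : ψ ≫ biprod.fst ≫ biprod.snd = μ := by simp [ψ]
  have e₃ : ψ ≫ biprod.snd = desc A.pr₂ A.pr₁ := by simp [ψ]
  rw [e₁] at f₁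
  rw [e₂] at f₂
  rw [e₃] at f₃
  refine ⟨_, _, _, ⟨f₁, ?_, ?_⟩, ⟨f₂, ?_, ?_⟩, ⟨f₃, ?_, ?_⟩, ?_⟩
  · rw [Category.assoc, h₂]; simp
  · rw [Category.assoc, h₃]; simp
  · rw [Category.assoc, h₁]; simp
  · rw [Category.assoc, h₃]; simp
  · rw [Category.assoc, h₁]; simp
  · rw [Category.assoc, h₂]; simp
  · rw [← hψφ]
    simp only [← Category.assoc, ← Preadditive.add_comp]
    congr 1
    ext <;> simp [ψ]

end OrderedEtaleAlg

end Decomposition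

/-! ### Strict orders given by idempotents -/

section StrictOrder

variable {T : Type u} [Category.{v} T] [Abelian T] [MonoidalCategory T] [SymmetricCategory T]
  [MonoidalPreadditive T]

/-- Multiplication by the indicator function of the diagonal equalizes the two coprojections. -/
lemma EtalePairing.inl_comp_mulHom {X : T} [MonObj X] [IsCommMonObj X] {tr : X ⟶ 𝟙_ T}
    {c : 𝟙_ T ⟶ X ⊗ X} (h : EtalePairing tr c) :
    inl X X ≫ Points.mulHom ⟨c⟩ = inr X X ≫ Points.mulHom ⟨c⟩ := by
  have h1 : Points.mulHom ⟨c⟩ = (μ ≫ inr X X) ≫ Points.mulHom ⟨c⟩ := by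
    rw [← cancel_epi (λ_ (X ⊗ X)).hom, ← Points.desc_hom_left, ← h.desc_id, Points.desc_hom_left,
      Category.id_comp]
  have h2 : inl X X ≫ μ = 𝟙 X := by
    simpa [desc] using inl_desc (𝟙 X) (𝟙 X)
  rw [h1]
  have h3 : inr X X ≫ μ = 𝟙 X := by
    simpa [desc] using inr_desc (𝟙 X) (𝟙 X)
  rw [Category.assoc, reassoc_of% h2, reassoc_of% h3]

/-- On the locus where two maps `b`, `c` to `X` agree, `r (a, b)` and `r (a, c)` agree. -/
lemma EtalePairing.map_desc_mul {X D : T} [MonObj X] [IsCommMonObj X] [MonObj D] [IsCommMonObj D]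
    {tr : X ⟶ 𝟙_ T} {δ : 𝟙_ T ⟶ X ⊗ X} (h : EtalePairing tr δ) (r : Points (X ⊗ X))
    (a b c : X ⟶ D) [IsMonHom a] [IsMonHom b] [IsMonHom c] :
    Points.map (desc a b) r * Points.map (desc b c) ⟨δ⟩ =
      Points.map (desc a c) r * Points.map (desc b c) ⟨δ⟩ := by
  have h1 : b ≫ Points.mulHom (Points.map (desc b c) ⟨δ⟩) =
      c ≫ Points.mulHom (Points.map (desc b c) ⟨δ⟩) := by
    have h2 := congr($(h.inl_comp_mulHom) ≫ desc b c)
    rwa [Category.assoc, Category.assoc, Points.mulHom_comp,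
      reassoc_of% (inl_desc b c), reassoc_of% (inr_desc b c)] at h2
  rw [_root_.mul_comm, _root_.mul_comm (Points.map (desc a c) r)]
  ext
  rw [← Points.comp_mulHom, ← Points.comp_mulHom, Points.map_hom, Points.map_hom, Category.assoc,
    Category.assoc, Points.desc_comp_mulHom_right, h1, Points.desc_comp_mulHom_right]

variable [RigidCategory T]

/-- The indicator function `r` of a strict total order on the space with algebra of functions `X`,
where `δ` is the indicator function of the diagonal: `r` is an idempotent of the tensor square of
`X`, the square is the disjoint union of `{x < y}`, `{x = y}` and `{y < x}`, and the order is
transitive on points with values in étale algebras. -/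
structure IsStrictOrder {X : T} [MonObj X] [IsCommMonObj X] (δ r : Points (X ⊗ X)) : Prop where
  mul_self : r * r = r
  add_add : r + δ + Points.map (desc (inr X X) (inl X X)) r = 1
  trans : ∀ (D : T) [MonObj D] [IsCommMonObj D], IsEtale D →
    ∀ (a b c : X ⟶ D) [IsMonHom a] [IsMonHom b] [IsMonHom c],
      Points.map (desc a b) r * Points.map (desc b c) r * Points.map (desc a c) r =
        Points.map (desc a b) r * Points.map (desc b c) r

namespace IsStrictOrder

variable {X : T} [MonObj X] [IsCommMonObj X] {δ r : Points (X ⊗ X)}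

/-- `r (b, a)` is the value at `(a, b)` of the function `(x, y) ↦ r (y, x)`. -/
lemma map_swap {D : T} [MonObj D] [IsCommMonObj D] (a b : X ⟶ D) [IsMonHom a] [IsMonHom b]
    (r : Points (X ⊗ X)) :
    Points.map (desc a b) (Points.map (desc (inr X X) (inl X X)) r) =
      Points.map (desc b a) r := by
  ext
  simp [desc_comp]

/-- The opposite order. -/
lemma swap (h : IsStrictOrder δ r) :
    IsStrictOrder δ (Points.map (desc (inr X X) (inl X X)) r) where
  mul_self := by rw [← map_mul, h.mul_self]
  add_add := by
    have h1 : Points.map (desc (inr X X) (inl X X)) (Points.map (desc (inr X X) (inl X X)) r) =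
        r := by
      ext
      simp [desc_comp, desc_inl_inr]
    rw [h1, ← h.add_add]
    ring
  trans D _ _ hD a b c _ _ _ := by
    simp only [map_swap]
    have := h.trans D hD c b a
    rw [_root_.mul_comm (Points.map (desc b a) r), this]

/-- Trichotomy for points with values in an arbitrary algebra. -/
lemma map_add_add (h : IsStrictOrder δ r) {D : T} [MonObj D] [IsCommMonObj D] (a b : X ⟶ D)
    [IsMonHom a] [IsMonHom b] :
    Points.map (desc a b) r + Points.map (desc a b) δ + Points.map (desc b a) r = 1 := by
  rw [← map_swap a b, ← map_add, ← map_add, h.add_add, map_one]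

end IsStrictOrder

end StrictOrder

/-! ### The idempotent of an ordered étale algebra -/

section Idempotent

variable {T : Type u} [Category.{v} T] [Abelian T] [MonoidalCategory T] [SymmetricCategory T]
  [MonoidalPreadditive T] [RigidCategory T] (A : OrderedEtaleAlg T)

/-- An algebra morphism `w` out of `D` factors through the direct factor `M` cut out by the
idempotent `⟨η ≫ i⟩` as soon as it sends this idempotent to `1`. -/
lemma IsFactor.exists_hom {D M Z : T} [MonObj D] [IsCommMonObj D] [MonObj M] [IsCommMonObj M]
    [MonObj Z] [IsCommMonObj Z] {i : M ⟶ D} {p : D ⟶ M} (h : IsFactor i p) (w : D ⟶ Z)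
    [IsMonHom w] (hw : Points.map w ⟨η ≫ i⟩ = 1) : ∃ t : M ⟶ Z, IsMonHom t ∧ p ≫ t = w := by
  refine ⟨i ≫ w, ⟨?_, ?_⟩, ?_⟩
  · simpa [Points.one_hom] using congr(Points.hom $hw)
  · rw [← reassoc_of% h.tensorHom_mul, IsMonHom.mul_hom w, tensorHom_comp_tensorHom_assoc]
  · rw [← Category.assoc, h.comp_eq_mulHom, Points.mulHom_comp, hw, Points.mulHom_one,
      Category.comp_id]

/-- The idempotent `⟨η ≫ i⟩` cutting out a direct factor restricts to `1` on it. -/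
lemma IsFactor.map_eq_one {D M : T} [MonObj D] [IsCommMonObj D] [MonObj M] [IsCommMonObj M]
    {i : M ⟶ D} {p : D ⟶ M} [IsMonHom p] (h : IsFactor i p) :
    Points.map p ⟨η ≫ i⟩ = 1 := by
  ext
  simp [h.comp_eq_id, Points.one_hom]

namespace OrderedEtaleAlg

/-- The order relation of an ordered étale algebra is given by an idempotent. -/
lemma exists_isStrictOrder : ∃ (c : 𝟙_ T ⟶ A.alg.X ⊗ A.alg.X) (r : Points (A.alg.X ⊗ A.alg.X)),
    EtalePairing (algTrace A.alg.X) c ∧ IsStrictOrder ⟨c⟩ r := by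
  obtain ⟨c, hc⟩ := A.isEtale_alg.exists_etalePairing
  obtain ⟨s₁, s₂, s₃, ⟨f₁, h₁₂, h₁₃⟩, ⟨f₂, h₂₁, h₂₃⟩, ⟨f₃, h₃₁, h₃₂⟩, hs⟩ := A.exists_decomposition
  -- functions on the square can be compared on the three pieces
  have ext' (x y : Points (A.alg.X ⊗ A.alg.X))
      (e₁ : Points.map (desc A.pr₁ A.pr₂) x = Points.map (desc A.pr₁ A.pr₂) y)
      (e₂ : Points.map μ x = Points.map μ y)
      (e₃ : Points.map (desc A.pr₂ A.pr₁) x = Points.map (desc A.pr₂ A.pr₁) y) : x = y := by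
    have e₁ := congr($(congr(Points.hom $e₁)) ≫ s₁)
    have e₂ := congr($(congr(Points.hom $e₂)) ≫ s₂)
    have e₃ := congr($(congr(Points.hom $e₃)) ≫ s₃)
    simp only [Points.map_hom, Category.assoc] at e₁ e₂ e₃
    ext
    rw [← Category.comp_id x.hom, ← Category.comp_id y.hom, ← hs]
    simp only [Preadditive.comp_add, e₁, e₂, e₃]
  set r : Points (A.alg.X ⊗ A.alg.X) := ⟨η ≫ s₁⟩ with hr
  set δ : Points (A.alg.X ⊗ A.alg.X) := ⟨η ≫ s₂⟩ with hδ
  set r' : Points (A.alg.X ⊗ A.alg.X) := ⟨η ≫ s₃⟩ with hr'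
  have hsum : r + δ + r' = 1 := by
    apply Points.mulHom_injective
    rw [Points.mulHom_add, Points.mulHom_add, hr, hδ, hr', ← f₁.comp_eq_mulHom,
      ← f₂.comp_eq_mulHom, ← f₃.comp_eq_mulHom, hs, Points.mulHom_one]
  have r₁ : Points.map (desc A.pr₁ A.pr₂) r = 1 := f₁.map_eq_one
  have r₂ : Points.map μ r = 0 := by ext; simp [hr, h₁₂]
  have r₃ : Points.map (desc A.pr₂ A.pr₁) r = 0 := by ext; simp [hr, h₁₃]
  have δ₁ : Points.map (desc A.pr₁ A.pr₂) δ = 0 := by ext; simp [hδ, h₂₁]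
  have δ₂ : Points.map μ δ = 1 := f₂.map_eq_one
  have δ₃ : Points.map (desc A.pr₂ A.pr₁) δ = 0 := by ext; simp [hδ, h₂₃]
  have r'₁ : Points.map (desc A.pr₁ A.pr₂) r' = 0 := by ext; simp [hr', h₃₁]
  have r'₂ : Points.map μ r' = 0 := by ext; simp [hr', h₃₂]
  have r'₃ : Points.map (desc A.pr₂ A.pr₁) r' = 1 := f₃.map_eq_one
  have inrμ (x : Points A.alg.X) : Points.map μ (Points.map (inr A.alg.X A.alg.X) x) = x := by
    have : inr A.alg.X A.alg.X ≫ μ = 𝟙 _ := by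
      simpa [desc] using inr_desc (𝟙 A.alg.X) (𝟙 A.alg.X)
    ext
    simp [this]
  have hcμ : Points.map μ (⟨c⟩ : Points (A.alg.X ⊗ A.alg.X)) = 1 := by
    ext
    exact hc.comp_mul
  -- both functions are supported on the diagonal and restrict to `1` there
  have hδc : δ = ⟨c⟩ := by
    have e₁ : (⟨c⟩ : Points (A.alg.X ⊗ A.alg.X)) * δ = ⟨c⟩ := by
      rw [Points.copairing_mul hc, δ₂, map_one, _root_.mul_one]
    have e₂ : δ * ⟨c⟩ = δ := by
      apply ext' <;> simp [δ₁, δ₂, δ₃, hcμ]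
    rw [← e₂, _root_.mul_comm, e₁]
  have hswap : Points.map (desc (inr A.alg.X A.alg.X) (inl A.alg.X A.alg.X)) r = r' := by
    apply ext'
    · rw [IsStrictOrder.map_swap, r₃, r'₁]
    · have : desc (𝟙 A.alg.X) (𝟙 A.alg.X) = μ := by simp [desc]
      have e := IsStrictOrder.map_swap (𝟙 A.alg.X) (𝟙 A.alg.X) r
      simp only [this] at e
      rw [e, r₂, r'₂]
    · rw [IsStrictOrder.map_swap, r₁, r'₃]
  refine ⟨c, r, hc, ⟨?_, by rw [hswap, ← hδc, hsum], ?_⟩⟩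
  · apply ext' <;> simp [r₁, r₂, r₃]
  · intro D _ _ hD a b c _ _ _
    have hrr : r * r = r := by apply ext' <;> simp [r₁, r₂, r₃]
    set g := Points.map (desc a b) r * Points.map (desc b c) r with hg
    have hgg : g * g = g := by
      rw [hg, _root_.mul_mul_mul_comm, ← map_mul, ← map_mul, hrr]
    -- it suffices to prove `a < c` on the open and closed subspace where `a < b` and `b < c`.
    obtain ⟨M, _, _, i, p, hip, hpi⟩ := exists_isFactor g hgg
    have := hip.isMonHom
    have hM : IsEtale M := hD.factor hip
    have hgi : g = ⟨η ≫ i⟩ := Points.mulHom_injective (by rw [← hpi, hip.comp_eq_mulHom])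
    have hpg : Points.map p g = 1 := by rw [hgi, hip.map_eq_one]
    have one_of_mul {x y : Points M} (hx : x * x = x) (hxy : x * y = 1) : x = 1 := by
      calc x = x * (x * y) := by rw [hxy, _root_.mul_one]
        _ = 1 := by rw [← _root_.mul_assoc, hx, hxy]
    have map_p (a b : A.alg.X ⟶ D) [IsMonHom a] [IsMonHom b] :
        Points.map p (Points.map (desc a b) r) = Points.map (desc (a ≫ p) (b ≫ p)) r := by
      ext
      simp [desc_comp]
    have idem (a b : A.alg.X ⟶ M) [IsMonHom a] [IsMonHom b] :
        Points.map (desc a b) r * Points.map (desc a b) r = Points.map (desc a b) r := by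
      rw [← map_mul, hrr]
    rw [hg, map_mul, map_p, map_p] at hpg
    have hrel (a b : A.alg.X ⟶ M) [IsMonHom a] [IsMonHom b] (h : Points.map (desc a b) r = 1) :
        A.lt.Rel (T := Opposite.op (EtaleAlg.of M hM)) (EtaleAlg.ofHom (Y := .of M hM) a).op
          (EtaleAlg.ofHom (Y := .of M hM) b).op := by
      obtain ⟨t, _, ht⟩ := f₁.exists_hom (desc a b) h
      refine ⟨(EtaleAlg.ofHom (X := A.lt.R.unop) (Y := .of M hM) t).op, ?_, ?_⟩
      · refine Quiver.Hom.unop_inj (EtaleAlg.hom_ext ?_)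
        have := congr(inl _ _ ≫ $ht)
        rw [← Category.assoc, inl_desc, inl_desc] at this
        exact this
      · refine Quiver.Hom.unop_inj (EtaleAlg.hom_ext ?_)
        have := congr(inr _ _ ≫ $ht)
        rw [← Category.assoc, inr_desc, inr_desc] at this
        exact this
    obtain ⟨t, ht₁, ht₂⟩ := A.transitive _ _ _ _
      (hrel (a ≫ p) (b ≫ p) (one_of_mul (idem _ _) hpg))
      (hrel (b ≫ p) (c ≫ p) (one_of_mul (idem _ _) ((_root_.mul_comm _ _).trans hpg)))
    have hac : Points.map (desc (a ≫ p) (c ≫ p)) r = 1 := by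
      have e₁ : A.pr₁ ≫ EtaleAlg.toHom t.unop = a ≫ p :=
        congr(EtaleAlg.toHom (Quiver.Hom.unop $ht₁))
      have e₂ : A.pr₂ ≫ EtaleAlg.toHom t.unop = c ≫ p :=
        congr(EtaleAlg.toHom (Quiver.Hom.unop $ht₂))
      have e₃ := congr(Points.map (EtaleAlg.toHom t.unop) $r₁)
      rw [map_one] at e₃
      rw [← e₃]
      ext
      simp [desc_comp, ← e₁, ← e₂]
    ext
    rw [← Points.comp_mulHom, ← hpi, ← Category.assoc, ← Points.map_hom p, map_p, hac, hgi]
    rfl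

end OrderedEtaleAlg

end Idempotent

/-! ### Connected components -/

section Points

variable {T : Type u} [Category.{v} T] [MonoidalCategory T] [SymmetricCategory T] [Preadditive T]
  [MonoidalPreadditive T] {k : Type w} [Field k] [Linear k T] [MonoidalLinear k T]

lemma Points.map_smul {D D' : T} [MonObj D] [IsCommMonObj D] [MonObj D'] [IsCommMonObj D']
    (f : D ⟶ D') [IsMonHom f] (a : k) (x : Points D) :
    Points.map f (a • x) = a • Points.map f x := by
  ext
  simp

variable (k) in
/-- An idempotent `e` of the ring of points of `X` which cuts out a field extension of `k` of
exponent characteristic `q` that is purely inseparable: every element of the factor cut out by `e`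
has a `q`-power-th power which is a scalar. The case `e = 0` is allowed. -/
structure IsGeometricPoint {X : T} [MonObj X] [IsCommMonObj X] (q : ℕ) (e : Points X) : Prop where
  mul_self : e * e = e
  exists_pow_eq : ∀ f : Points X, f * e = f → ∃ (n : ℕ) (a : k), f ^ q ^ n = a • e

namespace IsGeometricPoint

variable {X : T} [MonObj X] [IsCommMonObj X] {q : ℕ} [ExpChar k q] {e : Points X}

/-- A function on the component cut out by `e` takes the same value at any two points of this
component. -/
lemma mul_sub_eq_zero (he : IsGeometricPoint k q e) [IsReduced (Points (X ⊗ X))] (f : Points X)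
    (hf : f * e = f) :
    Points.map (inl X X) e * Points.map (inr X X) e *
      (Points.map (inl X X) f - Points.map (inr X X) f) = 0 := by
  obtain ⟨n, a, hn⟩ := he.exists_pow_eq f hf
  cases subsingleton_or_nontrivial (Points (X ⊗ X))
  · exact Subsingleton.elim _ _
  have : ExpChar (Points (X ⊗ X)) q :=
    expChar_of_injective_algebraMap (algebraMap k (Points (X ⊗ X))).injective q
  have hq : q ^ n ≠ 0 := (expChar_pow_pos k q n).ne'
  refine eq_zero_of_pow_eq_zero (n := q ^ n) ?_
  rw [mul_pow, sub_pow_expChar_pow, ← map_pow, ← map_pow, hn, Points.map_smul, Points.map_smul,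
    ← Nat.succ_pred hq, pow_succ]
  have h1 : Points.map (inl X X) e * Points.map (inr X X) e *
      (a • Points.map (inl X X) e - a • Points.map (inr X X) e) = 0 := by
    have e₁ := congr(Points.map (inl X X) $he.mul_self)
    have e₂ := congr(Points.map (inr X X) $he.mul_self)
    rw [map_mul] at e₁ e₂
    simp only [Algebra.smul_def]
    linear_combination algebraMap k (Points (X ⊗ X)) a * (Points.map (inr X X) e * e₁ -
      Points.map (inl X X) e * e₂)
  rw [_root_.mul_assoc, h1, mul_zero]

/-- An element `f` of the component cut out by `e` with `-f` idempotent is trivial. -/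
lemma eq_zero_or_eq (he : IsGeometricPoint k q e) {f : Points X} (hf : f * f = -f)
    (hfe : f * e = f) : f = 0 ∨ f = -e := by
  have hidem : IsIdempotentElem (-f) := by
    rw [IsIdempotentElem, neg_mul_neg, hf]
  obtain ⟨n, a, hn⟩ := he.exists_pow_eq (-f) (by rw [neg_mul, hfe])
  rw [hidem.pow_eq (expChar_pow_pos k q n).ne'] at hn
  have h2 : (a * a - a) • e = 0 := by
    have := hidem.eq
    rw [hn, smul_mul_smul_comm, he.mul_self] at this
    rw [sub_smul, this, sub_self]
  rcases smul_eq_zero.1 h2 with h | h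
  · have : a * (a - 1) = 0 := by linear_combination h
    rcases mul_eq_zero.1 this with h | h
    · left
      rwa [h, zero_smul, neg_eq_zero] at hn
    · right
      rw [sub_eq_zero.1 h, one_smul] at hn
      rw [← hn, neg_neg]
  · left
    rwa [h, smul_zero, neg_eq_zero] at hn

end IsGeometricPoint

end Points

/-! ### The exchange of the last two factors of a triple tensor product -/

section Swap

variable {T : Type u} [Category.{v} T] [MonoidalCategory T] [SymmetricCategory T] [Preadditive T]
  [MonoidalPreadditive T]
  {D D' A B : T} [MonObj D] [IsCommMonObj D] [MonObj D'] [IsCommMonObj D'] [MonObj A]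
  [IsCommMonObj A] [MonObj B] [IsCommMonObj B]

lemma inl_whiskerRight (f : D ⟶ D') : inl D A ≫ f ▷ A = f ≫ inl D' A := by
  rw [inl, inl, Category.assoc, whisker_exchange, rightUnitor_inv_naturality_assoc]

lemma inr_whiskerRight (f : D ⟶ D') [IsMonHom f] : inr D A ≫ f ▷ A = inr D' A := by
  rw [inr, inr, Category.assoc, ← comp_whiskerRight, IsMonHom.one_hom]

lemma inl_braiding : inl D A ≫ (β_ D A).hom = inr A D := by
  simp [inl, inr]

lemma inr_braiding : inr D A ≫ (β_ D A).hom = inl A D := by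
  simp [inl, inr]

lemma inl_whiskerLeft (f : A ⟶ B) [IsMonHom f] : inl D A ≫ D ◁ f = inl D B := by
  rw [inl, inl, Category.assoc, ← MonoidalCategory.whiskerLeft_comp, IsMonHom.one_hom]

lemma inr_whiskerLeft (f : A ⟶ B) : inr D A ≫ D ◁ f = f ≫ inr D B := by
  rw [inr, inr, Category.assoc, ← whisker_exchange, leftUnitor_inv_naturality_assoc]

lemma inl_associator : inl (D ⊗ A) B ≫ (α_ D A B).hom = D ◁ inl A B := by
  simp [inl]

lemma inr_associator : inr (D ⊗ A) B ≫ (α_ D A B).hom = inr A B ≫ inr D (A ⊗ B) := by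
  have h : inr (D ⊗ A) B = (λ_ B).inv ≫ ((λ_ (𝟙_ T)).inv ≫ 𝟙_ T ◁ η[A]) ▷ B ≫ η[D] ▷ A ▷ B := by
    rw [inr, tensorObj.one_def, MonoidalCategory.tensorHom_def', ← comp_whiskerRight,
      Category.assoc]
  rw [h, ← leftUnitor_inv_naturality, comp_whiskerRight, leftUnitor_inv_whiskerRight, inr, inr]
  simp only [Category.assoc, associator_naturality_left, Iso.inv_hom_id_assoc]

lemma inl_inl_swapLast :
    (inl D A ≫ inl (D ⊗ A) A) ≫ Points.swapLast D A = inl D A ≫ inl (D ⊗ A) A := by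
  rw [← cancel_mono (α_ D A A).hom]
  simp only [Category.assoc, Points.swapLast, Iso.inv_hom_id, Category.comp_id, inl_associator,
    reassoc_of% (inl_associator (D := D) (A := A) (B := A)), inl_whiskerLeft]
  rw [reassoc_of% (inl_whiskerLeft (D := D) (inl A A)), inl_whiskerLeft]

lemma inr_inl_swapLast : (inr D A ≫ inl (D ⊗ A) A) ≫ Points.swapLast D A = inr (D ⊗ A) A := by
  simp only [← Category.assoc, Iso.comp_inv_eq, Points.swapLast]
  simp only [Category.assoc, reassoc_of% (inl_associator (D := D) (A := A) (B := A)),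
    inr_associator]
  rw [reassoc_of% (inr_whiskerLeft (D := D) (inl A A)), inr_whiskerLeft,
    reassoc_of% (inl_braiding (D := A) (A := A))]

lemma inr_swapLast : inr (D ⊗ A) A ≫ Points.swapLast D A = inr D A ≫ inl (D ⊗ A) A := by
  simp only [← Category.assoc, Iso.comp_inv_eq, Points.swapLast]
  simp only [Category.assoc, reassoc_of% (inr_associator (D := D) (A := A) (B := A)),
    inl_associator]
  rw [inr_whiskerLeft, inr_whiskerLeft, reassoc_of% (inr_braiding (D := A) (A := A))]

end Swap

/-! ### The measure of an interval -/

section Trace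

variable {T : Type u} [Category.{v} T] [Abelian T] [MonoidalCategory T] [SymmetricCategory T]
  [MonoidalPreadditive T] [RigidCategory T] {k : Type w} [Field k] [Linear k T]
  [MonoidalLinear k T]

open Points

variable {X : T} [MonObj X] [IsCommMonObj X] {tr : X ⟶ 𝟙_ T} {c : 𝟙_ T ⟶ X ⊗ X}
  {r : Points (X ⊗ X)} {q : ℕ} [ExpChar k q] {e : Points X}

/-- The square of the measure of `{y | x < y}` is the measure of
`{(y, z) | x < y < z} ∪ {(y, z) | x < y = z} ∪ {(y, z) | x < z < y}`. -/
lemma IsStrictOrder.integral_mul_integral (hX : IsEtale X) (hc : EtalePairing tr c)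
    (hr : IsStrictOrder ⟨c⟩ r) (he : e * e = e) :
    integral tr (r * map (inr X X) e) * integral tr (r * map (inr X X) e) =
      2 * integral tr (r * map (inr X X) (e * integral tr (r * map (inr X X) e))) +
        integral tr (r * map (inr X X) e) := by
  set h := integral tr (r * map (inr X X) e) with hh
  -- the three coordinates of a point `(x, y, z)` of the cube
  let x : X ⟶ (X ⊗ X) ⊗ X := inl X X ≫ inl (X ⊗ X) X
  let y : X ⟶ (X ⊗ X) ⊗ X := inr X X ≫ inl (X ⊗ X) X
  let z : X ⟶ (X ⊗ X) ⊗ X := inr (X ⊗ X) X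
  have hF : IsEtale ((X ⊗ X) ⊗ X) := (hX.tensor hX).tensor hX
  have m₁₂ (u : Points (X ⊗ X)) : map (inl (X ⊗ X) X) u = map (desc x y) u := by
    have : desc x y = inl (X ⊗ X) X := (eq_desc _).symm
    simp only [this]
  have m₁₃ (u : Points (X ⊗ X)) : map (inl X X ▷ X) u = map (desc x z) u := by
    have : desc x z = inl X X ▷ X := by
      apply hom_ext_tensor <;> simp [x, z, inl_whiskerRight, inr_whiskerRight]
    simp only [this]
  have m₂₃ (u : Points (X ⊗ X)) : map (inr X X ▷ X) u = map (desc y z) u := by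
    have : desc y z = inr X X ▷ X := by
      apply hom_ext_tensor <;> simp [y, z, inl_whiskerRight, inr_whiskerRight]
    simp only [this]
  -- exchanging the variables `y` and `z`
  have s_x : x ≫ swapLast X X = x := inl_inl_swapLast
  have s_y : y ≫ swapLast X X = z := inr_inl_swapLast
  have s_z : z ≫ swapLast X X = y := inr_swapLast
  -- the double integral of a product of functions of `(x, y)` and of `(y, z)`
  have iter (u v : Points (X ⊗ X)) :
      integral tr (integral tr (map (desc x y) u * map (desc y z) v)) =
        integral tr (u * map (inr X X) (integral tr v)) := by
    rw [← m₁₂, ← m₂₃, integral_inl_mul, integral_map]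
  have hmap (a b : X ⟶ (X ⊗ X) ⊗ X) [IsMonHom a] [IsMonHom b] (u : Points (X ⊗ X))
      (v : Points X) : map (desc a b) (u * map (inr X X) v) = map (desc a b) u * map b v := by
    rw [map_mul, map_map]
    simp
  have h₀ : h * h = integral tr (integral tr
      (map (desc x y) (r * map (inr X X) e) * map (desc x z) (r * map (inr X X) e))) := by
    rw [← m₁₂, ← m₁₃, integral_inl_mul, integral_map, ← hh,
      _root_.mul_comm (r * map (inr X X) e), integral_inl_mul, ← hh]
  have t₁ : integral tr (integral tr
      (map (desc x y) (r * map (inr X X) e) * map (desc y z) (r * map (inr X X) e))) =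
        integral tr (r * map (inr X X) (e * h)) := by
    rw [iter, ← hh, map_mul (map (inr X X)), _root_.mul_assoc]
  have t₂ : integral tr (integral tr
      (map (desc x y) (r * map (inr X X) e) * map (desc y z) (⟨c⟩ * map (inr X X) e))) = h := by
    rw [iter, integral_copairing_mul hc, _root_.mul_assoc, ← map_mul, he]
  have t₃ : integral tr (integral tr
      (map (desc x z) (r * map (inr X X) e) * map (desc z y) (r * map (inr X X) e))) =
        integral tr (r * map (inr X X) (e * h)) := by
    rw [← t₁, ← integral_integral_swapLast, map_mul, map_map, map_map]
    simp only [desc_comp, s_x, s_y, s_z]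
  -- the trichotomy for `y` and `z`; transitivity makes one of the three inequalities redundant
  have key : map (desc x y) (r * map (inr X X) e) * map (desc x z) (r * map (inr X X) e) =
      map (desc x y) (r * map (inr X X) e) * map (desc y z) (r * map (inr X X) e) +
      map (desc x y) (r * map (inr X X) e) * map (desc y z) (⟨c⟩ * map (inr X X) e) +
      map (desc x z) (r * map (inr X X) e) * map (desc z y) (r * map (inr X X) e) := by
    have k₁ := hr.map_add_add y z
    have k₂ := hr.trans _ hF x y z
    have k₃ := hr.trans _ hF x z y
    have k₄ := hc.map_desc_mul r x y z
    have k₅ := congr(Points.map (desc x y) $hr.mul_self)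
    rw [map_mul] at k₅
    simp only [hmap]
    linear_combination map y e * map z e * (- map (desc x y) r * map (desc x z) r * k₁ + k₂ + k₃ -
      map (desc x y) r * k₄ + map (desc y z) ⟨c⟩ * k₅)
  rw [h₀, key, map_add, map_add, map_add, map_add, t₁, t₂, t₃]
  ring

/-- The measure of `{y | x < y}`, computed inside the component cut out by `e`, is `0` or `-1`. -/
lemma IsStrictOrder.mul_integral_eq (hX : IsEtale X) (hc : EtalePairing tr c)
    (hr : IsStrictOrder ⟨c⟩ r) (he : IsGeometricPoint k q e) :
    e * integral tr (r * map (inr X X) e) = 0 ∨ e * integral tr (r * map (inr X X) e) = -e := by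
  have : IsReduced (Points (X ⊗ X)) := (hX.tensor hX).isReduced_points
  have h₀ := hr.integral_mul_integral hX hc he.mul_self
  set h := integral tr (r * map (inr X X) e) with hh
  have hfe : e * h * e = e * h := by rw [_root_.mul_right_comm, he.mul_self]
  refine he.eq_zero_or_eq ?_ hfe
  have h₁ := he.mul_sub_eq_zero (e * h) hfe
  have h₂ : e * integral tr (r * map (inr X X) (e * h)) = e * h * h := by
    have h₃ : e * h * h = integral tr (map (inl X X) (e * h) * (r * map (inr X X) e)) := by
      rw [integral_inl_mul, ← hh]
    rw [h₃, ← integral_inl_mul]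
    congr 1
    -- the integrand only involves points `x`, `y` of the component of `e`, where `h x = h y`
    have e₁ := congr(Points.map (inl X X) $he.mul_self)
    have e₂ := congr(Points.map (inr X X) $he.mul_self)
    simp only [map_mul] at h₁ e₁ e₂ ⊢
    linear_combination (-r : Points (X ⊗ X)) * h₁ +
      r * Points.map (inr X X) e * Points.map (inl X X) h * e₁ -
        r * Points.map (inl X X) e * Points.map (inr X X) h * e₂
  linear_combination (-1 : Points X) * e * h₀ - 2 * h₂ + h * h * he.mul_self

/-- The trace of an idempotent cutting out a geometric point of an ordered étale algebra. -/
lemma IsStrictOrder.trace_eq (hX : IsEtale X) (hc : EtalePairing tr c)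
    (hr : IsStrictOrder ⟨c⟩ r) (he : IsGeometricPoint k q e)
    (hk : Function.Bijective (algebraMap k (End (𝟙_ T)))) :
    e.hom ≫ tr = 𝟙 _ ∨ e.hom ≫ tr = - 𝟙 _ ∨ e.hom ≫ tr = 0 := by
  obtain ⟨a, ha⟩ := hk.2 (e.hom ≫ tr)
  have ha : e.hom ≫ tr = a • 𝟙 _ := by rw [← ha, Algebra.algebraMap_eq_smul_one]; rfl
  have h₀ : integral tr (map (inr X X) e) = a • 1 := by
    ext
    rw [integral_inr, ha]
    simp [one_hom]
  have h₁ : integral tr (map (inr X X) e) = integral tr (r * map (inr X X) e) + e +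
      integral tr (map (desc (inr X X) (inl X X)) r * map (inr X X) e) := by
    have := congr(integral tr ($hr.add_add * map (inr X X) e))
    rw [_root_.one_mul, add_mul, add_mul, map_add, map_add, integral_copairing_mul hc] at this
    exact this.symm
  have h₂ : a • e = e * integral tr (r * map (inr X X) e) + e +
      e * integral tr (map (desc (inr X X) (inl X X)) r * map (inr X X) e) := by
    have : a • e = e * integral tr (map (inr X X) e) := by
      rw [h₀, mul_smul_comm, _root_.mul_one]
    rw [this, h₁, mul_add, mul_add, he.mul_self]
  have key : a • e = e ∨ a • e = -e ∨ a • e = 0 := by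
    rcases hr.mul_integral_eq hX hc he with h | h <;>
    rcases hr.swap.mul_integral_eq hX hc he with h' | h' <;>
    rw [h₂, h, h'] <;> simp
  rcases eq_or_ne e 0 with rfl | he0
  · right; right; simp
  rw [ha]
  have inj {b : k} (hb : a • e = b • e) : a = b := by
    rw [← sub_eq_zero, ← sub_smul] at hb
    exact sub_eq_zero.1 ((smul_eq_zero.1 hb).resolve_right he0)
  rcases key with h | h | h
  · left
    rw [inj (b := 1) (by rw [h, one_smul]), one_smul]
  · right; left
    rw [inj (b := -1) (by rw [h, neg_smul, one_smul]), neg_smul, one_smul]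
  · right; right
    rw [inj (b := 0) (by rw [h, zero_smul]), zero_smul]

end Trace

/-! ### Finite reduced algebras over a separably closed field -/

section Ring

/-- A finite reduced algebra over a separably closed field is a product of purely inseparable field
extensions. -/
lemma exists_geometricPoints (k : Type w) [Field k] [IsSepClosed k] (q : ℕ) [ExpChar k q]
    (R : Type v) [CommRing R] [Algebra k R] [Module.Finite k R] [IsReduced R] :
    ∃ (S : Type v) (_ : Fintype S) (e : S → R), ∑ i, e i = 1 ∧ ∀ i, e i * e i = e i ∧
      ∀ f : R, f * e i = f → ∃ (n : ℕ) (a : k), f ^ q ^ n = a • e i := by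
  classical
  have : IsArtinianRing R := IsArtinianRing.of_finite k R
  have : Fintype (MaximalSpectrum R) := Fintype.ofFinite _
  let φ := (IsArtinianRing.equivPi R).toRingEquiv
  refine ⟨MaximalSpectrum R, inferInstance, fun i => φ.symm (Pi.single i 1), ?_, fun i => ⟨?_, ?_⟩⟩
  · apply φ.injective
    rw [map_sum, map_one]
    simp only [RingEquiv.apply_symm_apply]
    exact Finset.univ_sum_single 1
  · rw [← map_mul, ← Pi.single_mul, _root_.mul_one]
  · intro f hf
    let := Ideal.Quotient.field i.asIdeal
    obtain ⟨n, a, ha⟩ := IsPurelyInseparable.pow_mem k q (φ f i)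
    refine ⟨n, a, φ.injective ?_⟩
    have hf' : φ f = Pi.single i (φ f i) := by
      rw [← hf, map_mul, RingEquiv.apply_symm_apply]
      ext j
      rcases eq_or_ne j i with rfl | h
      · simp
      · simp [h]
    have h1 : φ (a • φ.symm (Pi.single i 1)) = Pi.single i (algebraMap k _ a) := by
      rw [Algebra.smul_def, map_mul, RingEquiv.apply_symm_apply]
      ext j
      rcases eq_or_ne j i with rfl | h
      · simp
        rfl
      · simp [h]
    rw [h1, map_pow, hf', ha]
    ext j
    rcases eq_or_ne j i with rfl | h
    · simp
    · rw [Pi.pow_apply, Pi.single_eq_of_ne h, Pi.single_eq_of_ne h,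
        zero_pow (expChar_pow_pos k q n).ne']

end Ring

/-! ### Simple algebras, and the dimension as a trace -/

section Dimension

variable {T : Type u} [Category.{v} T] [MonoidalCategory T] [SymmetricCategory T]

/-- The dimension of an algebra is the trace of its unit. -/
lemma one_comp_algTrace (X : T) [MonObj X] [HasRightDual X] :
    η[X] ≫ algTrace X = dim X := by
  rw [algTrace, dim, rightUnitor_inv_naturality_assoc, ← whisker_exchange_assoc,
    associator_inv_naturality_left_assoc, ← comp_whiskerRight_assoc, MonObj.one_mul]
  simp [← unitors_inv_equal]

end Dimension

section Simple

variable {T : Type u} [Category.{v} T] [Abelian T] [MonoidalCategory T] [SymmetricCategory T]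
  [MonoidalPreadditive T] {X : T} [MonObj X] [IsCommMonObj X]

/-- An idempotent point of a simple algebra is trivial, because the kernel of the multiplication by
it is an ideal. -/
lemma IsSimpleAlgebra.eq_zero_or_eq_one (hX : IsSimpleAlgebra X) (e : Points X) (he : e * e = e) :
    e = 0 ∨ e = 1 := by
  rcases hX.2 (kernel e.mulHom) (kernel.ι e.mulHom)
    ⟨kernel.lift _ (X ◁ kernel.ι e.mulHom ≫ μ) (by
      rw [Category.assoc, Points.mul_comp_mulHom_right, ← MonoidalCategory.whiskerLeft_comp_assoc,
        kernel.condition, MonoidalPreadditive.whiskerLeft_zero, zero_comp]), kernel.lift_ι _ _ _⟩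
    with h | h
  · right
    have : Mono e.mulHom := Preadditive.mono_of_isZero_kernel _ h
    apply Points.mulHom_injective
    rw [← cancel_mono e.mulHom, ← Points.mulHom_mul, he, Points.mulHom_one, Category.id_comp]
  · left
    apply Points.mulHom_injective
    rw [← cancel_epi (kernel.ι e.mulHom), kernel.condition, Points.mulHom_zero, comp_zero]

lemma IsSimpleAlgebra.nontrivial_points (hX : IsSimpleAlgebra X) : Nontrivial (Points X) := by
  refine ⟨1, 0, fun h => hX.1 ?_⟩
  rw [IsZero.iff_id_eq_zero, ← Points.mulHom_one, h, Points.mulHom_zero]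

end Simple

/-! ### The dimension of an ordered étale algebra -/

section Sum

/-- The unit of an ordered étale algebra is a sum of idempotents of trace `1`, `-1` or `0`. -/
lemma OrderedEtaleAlg.exists_idempotents (k : Type w) [Field k] [IsSepClosed k]
    {T : Type u} [Category.{v} T] [Abelian T] [Linear k T] [MonoidalCategory T]
    [SymmetricCategory T] [MonoidalPreadditive T] [MonoidalLinear k T] [RigidCategory T]
    [IsPreTannakian k T] (A : OrderedEtaleAlg T) :
    ∃ (S : Type v) (_ : Fintype S) (e : S → Points A.alg.X), ∑ i, e i = 1 ∧ ∀ i,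
      e i * e i = e i ∧ ((e i).hom ≫ algTrace A.alg.X = 𝟙 _ ∨
        (e i).hom ≫ algTrace A.alg.X = -𝟙 _ ∨ (e i).hom ≫ algTrace A.alg.X = 0) := by
  obtain ⟨c, r, hc, hr⟩ := A.exists_isStrictOrder
  have : Module.Finite k (𝟙_ T ⟶ A.alg.X) := IsPreTannakian.finite_hom _ _
  have : Module.Finite k (Points A.alg.X) :=
    Module.Finite.equiv (Points.homLinearEquiv (k := k) (X := A.alg.X)).symm
  have : IsReduced (Points A.alg.X) := A.isEtale_alg.isReduced_points
  obtain ⟨S, _, e, hsum, he⟩ := exists_geometricPoints k (ringExpChar k) (Points A.alg.X)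
  refine ⟨S, inferInstance, e, hsum, fun i => ⟨(he i).1, ?_⟩⟩
  exact hr.trace_eq (k := k) A.isEtale_alg hc ⟨(he i).1, (he i).2⟩ IsPreTannakian.end_unit

end Sum

end OrderedEtale

theorem mainTheorem5 {k : Type w} [Field k] [IsSepClosed k]
    {T : Type u} [Category.{v} T] [Abelian T] [Linear k T]
    [MonoidalCategory T] [SymmetricCategory T] [MonoidalPreadditive T] [MonoidalLinear k T]
    [RigidCategory T] [OrderedEtale.IsPreTannakian k T]
    (A : OrderedEtale.OrderedEtaleAlg T) :
    (OrderedEtale.IsSimpleAlgebra A.alg.X →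
      OrderedEtale.dim A.alg.X = 1 ∨ OrderedEtale.dim A.alg.X = -1 ∨
        OrderedEtale.dim A.alg.X = 0) ∧
    ∃ n : ℤ, OrderedEtale.dim A.alg.X = (n : End (𝟙_ T)) := by
  obtain ⟨S, _, e, hsum, he⟩ := OrderedEtale.OrderedEtaleAlg.exists_idempotents k A
  have hdim : OrderedEtale.dim A.alg.X =
      (1 : OrderedEtale.Points A.alg.X).hom ≫ OrderedEtale.algTrace A.alg.X :=
    (OrderedEtale.one_comp_algTrace A.alg.X).symm
  constructor
  · intro hA
    have := hA.nontrivial_points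
    obtain ⟨i, -, hi⟩ := Finset.exists_ne_zero_of_sum_ne_zero (hsum.trans_ne one_ne_zero)
    have h1 : e i = 1 := (hA.eq_zero_or_eq_one _ (he i).1).resolve_left hi
    rw [hdim, ← h1]
    exact (he i).2
  · have hsum' : OrderedEtale.dim A.alg.X =
        ∑ i, ((e i).hom ≫ OrderedEtale.algTrace A.alg.X : End (𝟙_ T)) := by
      rw [hdim, ← hsum, ← Preadditive.sum_comp]
      congr 1
      exact map_sum OrderedEtale.Points.homAddHom e Finset.univ
    have hmem : OrderedEtale.dim A.alg.X ∈ (Int.castRingHom (End (𝟙_ T))).range := by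
      rw [hsum']
      refine sum_mem fun i _ => ?_
      rcases (he i).2 with h | h | h <;> rw [h]
      · exact one_mem _
      · exact neg_mem (one_mem _)
      · exact zero_mem _
    obtain ⟨n, hn⟩ := hmem
    exact ⟨n, hn.symm⟩
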